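/- Let $S\subseteq[m]\times[n]$ and let $M=(m_{ij})_{(i,j)\in S}$ be a partial $m\times n$ matrix whose specified entries are exactly those at the positions in $S$ and are all positive real numbers. A *completion* of $M$ is a matrix $A\in\mathbb{R}^{m\times n}$ of rank one with nonnegative entries summing to $1$ (that is, $A$ lies in the standard simplex $\Delta^{mn-1}$) such that $a_{ij}=m_{ij}$ for all $(i,j)\in S$. Assume that $M$ is *completable*, i.e. that it has at least one completion. Let $G(S)$ be the bipartite graph whose vertices are the rows $r_1,\dots,r_m$ and the columns $c_1,\dots,c_n$, with an edge $r_ic_j$ for each $(i,j)\in S$. Let $\overline{M}$ be the block-diagonal partial matrix obtained from $M$ by completing along cycles: if $(i,j)\notin S$ and $r_i,c_j$ lie in the same connected component of $G(S)$, choose a path $r_{i_1},c_{j_2},r_{i_2},c_{j_3},\dots,c_{j_k},r_{i_k},c_{j_1}$ in $G(S)$ from $r_i=r_{i_1}$ to $c_j=c_{j_1}$ and set $$m_{ij}=\frac{m_{i_1j_2}\,m_{i_2j_3}\cdots m_{i_kj_1}}{m_{i_2j_2}\,m_{i_3j_3}\cdots m_{i_kj_k}} .$$ The blocks of $\overline{M}$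 are the connected components of $G(S)$, isolated vertices included. Let $s$ be the number of blocks, and for $i=1,\dots,s$ let $b_i$ be the sum of the entries of $\overline{M}$ in the $i$-th block (so $b_i=0$ for an isolated vertex). Then: 1. if $\sum_i\sqrt{b_i}=1$, then $M$ has a unique completion; 2. if $\sum_i\sqrt{b_i}<1$, $s=2$ and one component is an isolated vertex, then $M$ has a unique completion; 3. if $\sum_i\sqrt{b_i}<1$, $s=2$ and both components contain edges, then $M$ has exactly two completions; 4. if $\sum_i\sqrt{b_i}<1$ and $s>2$, then the set of completions of $M$ is an $(s-2)$-dimensional basic semialgebraic subset of $\mathbb{R}^{m\times n}$. Here a basic semialgebraic set is the solution set of a finite system of polynomial equations $f=0$ and inequalities $g\ge 0$, and the dimension of a semialgebraic set $X\subseteq\mathbb{R}^N$ is the Krull dimension of $\mathbb{R}[x_1,\dots,x_N]/I(X)$, where $I(X)$ is the ideal of polynomials vanishing on $X$. -/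

import Mathlib

/-! Rank-one completions of partial matrices in the standard simplex.

A pattern is a set `S` of positions of an `m × n` matrix, and a partial matrix subordinate to `S`
is a function `M : S → ℝ`, the value of `M` at a position being the specified entry there. -/

noncomputable section

namespace PartialMatrix

open scoped Classical in
/-- The value at position `(i, j)` of the partial matrix `M`; only used for `(i, j) ∈ S`. -/
def entry {m n : ℕ} {S : Set (Fin m × Fin n)} (M : S → ℝ) (i : Fin m) (j : Fin n) : ℝ :=
  if h : (i, j) ∈ S then M ⟨(i, j), h⟩ else 0

/-- A completion of `M`: a rank-one matrix in the standard simplex `Δ^{mn-1}` (nonnegative entries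
which sum to one) whose entries at the positions in `S` are those of `M`. -/
def completions {m n : ℕ} {S : Set (Fin m × Fin n)} (M : S → ℝ) :
    Set (Matrix (Fin m) (Fin n) ℝ) :=
  {A | A.rank = 1 ∧ Function.uncurry A ∈ stdSimplex ℝ (Fin m × Fin n) ∧
    ∀ e : S, A e.1.1 e.1.2 = M e}

/-- `M` is completable if it has a rank-one completion in the standard simplex. -/
def Completable {m n : ℕ} {S : Set (Fin m × Fin n)} (M : S → ℝ) : Prop :=
  (completions M).Nonempty

/-- The bipartite graph `G(S)`: the vertices are the rows (`Sum.inl`) and the columns (`Sum.inr`),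
and row `i` is joined to column `j` if and only if `(i, j) ∈ S`. -/
def graph {m n : ℕ} (S : Set (Fin m × Fin n)) : SimpleGraph (Fin m ⊕ Fin n) where
  Adj
    | .inl i, .inr j => (i, j) ∈ S
    | .inr j, .inl i => (i, j) ∈ S
    | _, _ => False
  symm := ⟨by rintro (i | j) (k | l) h <;> exact h⟩
  loopless := ⟨by rintro (i | j) h <;> exact h⟩

/-- The weight of the edge between two vertices of `G(S)`: the specified entry. -/
def weight {m n : ℕ} {S : Set (Fin m × Fin n)} (M : S → ℝ) : Fin m ⊕ Fin n → Fin m ⊕ Fin n → ℝ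
  | .inl i, .inr j => entry M i j
  | .inr j, .inl i => entry M i j
  | _, _ => 0

/-- The alternating quotient `w₁ / (w₂ / (w₃ / ⋯)) = (w₁ w₃ w₅ ⋯) / (w₂ w₄ ⋯)` of the weights
`w₁, w₂, w₃, …` of the successive edges of a walk. For a walk
`r₁, c₂, r₂, c₃, …, c_k, r_k, c₁` it is `(m_{r₁c₂} m_{r₂c₃} ⋯ m_{r_kc₁}) / (m_{r₂c₂} ⋯ m_{r_kc_k})`. -/
def altQuotient {m n : ℕ} {S : Set (Fin m × Fin n)} (M : S → ℝ) :
    {u v : Fin m ⊕ Fin n} → (graph S).Walk u v → ℝ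
  | _, _, .nil => 1
  | _, _, .cons (u := u) (v := v) _ p => weight M u v / altQuotient M p

/-- The positions of the edges of the transitive closure of `G(S)`: the pairs of a row and a column
in the same connected component. -/
def closurePattern {m n : ℕ} (S : Set (Fin m × Fin n)) : Set (Fin m × Fin n) :=
  {e | (graph S).Reachable (.inl e.1) (.inr e.2)}

open scoped Classical in
/-- The block-diagonal partial matrix obtained by completing `M` along cycles. Specified entries are
kept. For an unspecified position `(i, j)` in the transitive closure, a path of `G(S)` from row `i`
to column `j`, that is a cycle through `(i, j)` in `G(S ∪ {(i, j)})`, is chosen and the entry is the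
alternating quotient along it. -/
def cycleCompletion {m n : ℕ} {S : Set (Fin m × Fin n)} (M : S → ℝ) : closurePattern S → ℝ :=
  fun e => if h : e.1 ∈ S then M ⟨e.1, h⟩ else
    altQuotient M (SimpleGraph.Reachable.exists_isPath e.2).choose

/-- The blocks are the connected components of `G(S)`, isolated vertices included. -/
abbrev Block {m n : ℕ} (S : Set (Fin m × Fin n)) : Type := (graph S).ConnectedComponent

instance {m n : ℕ} (S : Set (Fin m × Fin n)) : Fintype (Block S) := Fintype.ofFinite _

open scoped Classical in
/-- The sum of the entries of the completed partial matrix in the block `c`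
(zero for an isolated vertex). -/
def blockSum {m n : ℕ} {S : Set (Fin m × Fin n)} (M : S → ℝ) (c : Block S) : ℝ :=
  ∑ e : closurePattern S with (graph S).connectedComponentMk (.inl e.1.1) = c, cycleCompletion M e

/-- The component `c` is an isolated vertex. -/
def IsIsolatedVertex {m n : ℕ} {S : Set (Fin m × Fin n)} (c : Block S) : Prop :=
  ∃ v, c.supp = {v}

/-- The component `c` contains an edge. -/
def HasEdge {m n : ℕ} {S : Set (Fin m × Fin n)} (c : Block S) : Prop :=
  ∃ v ∈ c.supp, ∃ w ∈ c.supp, (graph S).Adj v w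

/-- A basic (closed) semialgebraic subset of `ℝ^σ`: the solution set of a finite system of
polynomial equations `f = 0` and polynomial inequalities `g ≥ 0`. -/
def IsBasicSemialgebraic {σ : Type} (X : Set (σ → ℝ)) : Prop :=
  ∃ F G : Finset (MvPolynomial σ ℝ),
    X = {x | (∀ f ∈ F, MvPolynomial.eval x f = 0) ∧ ∀ g ∈ G, 0 ≤ MvPolynomial.eval x g}

/-- The dimension of a semialgebraic subset `X` of `ℝ^σ`: the Krull dimension of its ring of
polynomial functions `ℝ[x] / I(X)`, where `I(X)` is the ideal of the polynomials vanishing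
on `X`. -/
def semialgebraicDim {σ : Type} (X : Set (σ → ℝ)) : WithBot ℕ∞ :=
  ringKrullDim (MvPolynomial σ ℝ ⧸ MvPolynomial.vanishingIdeal ℝ X)

end PartialMatrix

end

noncomputable section

namespace PartialMatrix

/-! A rank-one matrix with total `1` is the outer product of its row sums and its column sums. On an
edge of the graph the product of the two sums is a prescribed positive number, so alternating
quotients along walks telescope (`altQuotient_eq`): every completion extends the cycle completion,
and inside a block the ratios between row sums, and between column sums, are forced. What remains
free is the row mass `p c` and the column mass `q c` of each block. Completions thus correspond
(`bijOn_completions`) to nonnegative `p`, `q`, each with sum `1`, such that `p c * q c = b c` (the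
block sum), vanishing on blocks without rows, respectively without columns.

The first three cases are then elementary. Since `∑ (√p - √q)² = 2 - 2 ∑ √b`, the equality `∑ √b =
1` forces `p = q = √b`. With two blocks, one of them isolated, the equations become linear. With two
blocks containing edges they amount to a quadratic equation, whose discriminant is positive by
`lt_mul_of_sqrt_add_sqrt_lt`.

For `s > 2` blocks, the two-minors give the semialgebraic description. Every polynomial function on
the completions is a fraction in one coordinate per block, with a power of the unit `edgeProd` as
denominator. The two sum conditions give a prime relation and a second one not divisible by it, so
the dimension is at most `s - 2`. Conversely, all coordinates but two can be prescribed in a small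
box (`IsAdaptablePair.exists_isBlockMass`), so a polynomial ring in `s - 2` variables embeds. -/

/-! ### Krull dimension bounds -/

/-- An injective integral ring homomorphism does not decrease the Krull dimension. -/
theorem ringKrullDim_le_of_isIntegral_of_injective {A R : Type*} [CommRing A] [CommRing R]
    (f : A →+* R) (hinj : Function.Injective f) (hint : f.IsIntegral) :
    ringKrullDim A ≤ ringKrullDim R := by
  let _ := f.toAlgebra
  have : Algebra.IsIntegral A R := ⟨hint⟩
  refine iSup_le fun l => ?_
  -- Lying over gives a prime above the bottom of the chain; going up lifts the rest without
  -- changing its length.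
  obtain ⟨Q, -, hQ, hQl⟩ := Ideal.exists_ideal_over_prime_of_isIntegral l.head.asIdeal (⊥ : Ideal R)
    (by
      intro a ha
      have h0 : f a = 0 := ha
      rw [(map_eq_zero_iff f hinj).1 h0]
      exact zero_mem _)
  have : Q.LiesOver l.head.asIdeal := ⟨hQl.symm⟩
  obtain ⟨L, hL, -⟩ := Ideal.exists_ltSeries_of_hasGoingUp l Q
  rw [← hL]
  exact le_iSup (fun p : LTSeries (PrimeSpectrum R) => ((p.length : ℕ∞) : WithBot ℕ∞)) L

/-- A finitely generated algebra over a field that is a domain and contains a polynomial ring in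
`#ι` variables has Krull dimension at least `#ι`. -/
theorem natCard_le_ringKrullDim_of_injective_of_isDomain {k R ι : Type} [Field k] [CommRing R]
    [IsDomain R] [Algebra k R] [Algebra.FiniteType k R] [Finite ι]
    (f : MvPolynomial ι k →ₐ[k] R) (hf : Function.Injective f) :
    (Nat.card ι : WithBot ℕ∞) ≤ ringKrullDim R := by
  -- Noether normalization: `R` is integral over a polynomial ring in `s` variables, so its
  -- dimension is at least `s`, while its transcendence degree is at most `s` and at least `#ι`.
  obtain ⟨s, g, hg, hint⟩ := exists_integral_inj_algHom_of_fg k R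
  have h1 : ringKrullDim (MvPolynomial (Fin s) k) ≤ ringKrullDim R :=
    ringKrullDim_le_of_isIntegral_of_injective g.toRingHom hg hint
  rw [MvPolynomial.ringKrullDim_of_isNoetherianRing, ringKrullDim_eq_zero_of_field, zero_add,
    Nat.card_fin] at h1
  refine le_trans ?_ h1
  have h2 : Algebra.trdeg k (MvPolynomial ι k) ≤ Algebra.trdeg k R :=
    trdeg_le_of_injective f hf
  have hadj : g.range = Algebra.adjoin k (Set.range fun i => g (MvPolynomial.X i)) := by
    rw [← Algebra.map_top, ← MvPolynomial.adjoin_range_X, AlgHom.map_adjoin, ← Set.range_comp]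
    rfl
  have : Algebra.IsAlgebraic
      (Algebra.adjoin k (Set.range fun i => g (MvPolynomial.X i))) R := by
    rw [← hadj]
    refine ⟨fun r => ?_⟩
    have : IsIntegral g.range r := by
      obtain ⟨p, hp, hp0⟩ := hint r
      refine ⟨p.map g.rangeRestrict.toRingHom, hp.map _, ?_⟩
      rw [Polynomial.eval₂_map]
      exact hp0
    exact this.isAlgebraic
  have h3 := Algebra.IsAlgebraic.trdeg_le_cardinalMk k
    (Set.range fun i => g (MvPolynomial.X i))
  have h4 : Cardinal.mk (Set.range fun i => g (MvPolynomial.X i)) ≤ s := by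
    simpa using Cardinal.mk_range_le (f := fun i => g (MvPolynomial.X i))
  have h5 := (h2.trans h3).trans h4
  rw [MvPolynomial.trdeg_of_isDomain, Cardinal.lift_id, ← Nat.cast_card,
    Nat.cast_le] at h5
  exact_mod_cast h5

/-- A finitely generated algebra over a field that contains a polynomial ring in `#ι` variables has
Krull dimension at least `#ι`. -/
theorem natCard_le_ringKrullDim_of_injective {k R ι : Type} [Field k] [CommRing R]
    [Algebra k R] [Algebra.FiniteType k R] [Finite ι]
    (f : MvPolynomial ι k →ₐ[k] R) (hf : Function.Injective f) :
    (Nat.card ι : WithBot ℕ∞) ≤ ringKrullDim R := by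
  have hbot : (⊥ : Ideal (MvPolynomial ι k)) ∈ minimalPrimes (MvPolynomial ι k) := by
    rw [IsDomain.minimalPrimes_eq_singleton_bot]
    rfl
  -- Some prime `Q` contracts to zero, so the polynomial ring still embeds in the domain `R ⧸ Q`.
  obtain ⟨Q, hQ, hcomap⟩ := Ideal.exists_comap_eq_of_mem_minimalPrimes_of_injective
    (f := f.toRingHom) hf _ hbot
  have hinj : Function.Injective ((Ideal.Quotient.mkₐ k Q).comp f) := by
    rw [injective_iff_map_eq_zero]
    intro a ha
    have : a ∈ Ideal.comap f.toRingHom Q :=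
      (Ideal.Quotient.eq_zero_iff_mem (I := Q) (a := f a)).1 ha
    rwa [hcomap] at this
  exact (natCard_le_ringKrullDim_of_injective_of_isDomain _ hinj).trans (ringKrullDim_quotient_le Q)

/-- If every element of `R` is a fraction of elements in the image of `A`, with invertible
denominator, then the dimension of `R` is at most that of `A`. -/
theorem ringKrullDim_le_of_fractions {A R : Type*} [CommRing A] [CommRing R] (φ : A →+* R)
    (h : ∀ r, ∃ a d, IsUnit (φ d) ∧ φ a = φ d * r) : ringKrullDim R ≤ ringKrullDim A := by
  -- A prime of `R` is determined by its contraction: `r` lies in it exactly when the numerator `φ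
  -- a` does. Hence contraction of primes preserves strict chains.
  have key : ∀ P Q : PrimeSpectrum R,
      P.comap φ = Q.comap φ → P.asIdeal ≤ Q.asIdeal := by
    intro P Q hPQ r hr
    obtain ⟨a, d, hd, had⟩ := h r
    have ha : a ∈ (P.comap φ).asIdeal := by
      change φ a ∈ P.asIdeal
      rw [had]
      exact Ideal.mul_mem_left _ _ hr
    rw [hPQ] at ha
    have ha' : φ d * r ∈ Q.asIdeal := had ▸ ha
    exact (Ideal.unit_mul_mem_iff_mem _ hd).1 ha'
  refine Order.krullDim_le_of_strictMono (PrimeSpectrum.comap φ)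
    (Monotone.strictMono_of_injective (fun _ _ hab => Ideal.comap_mono hab) fun P Q hPQ => ?_)
  exact PrimeSpectrum.ext (le_antisymm (key P Q hPQ) (key Q P hPQ.symm))

/-- If every element of `R` is a fraction of elements in the image of the domain `A` and the kernel
of `A → R` contains a prime element `f₁` and an element `f₂` not divisible by `f₁`, then the
dimension of `R` is at most that of `A` minus two. -/
theorem ringKrullDim_add_two_le_of_fractions {A R : Type*} [CommRing A] [IsDomain A] [CommRing R]
    (φ : A →+* R) (h : ∀ r, ∃ a d, IsUnit (φ d) ∧ φ a = φ d * r) {f₁ f₂ : A} (hf₁ : Prime f₁)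
    (hf₂ : ¬ f₁ ∣ f₂) (h₁ : φ f₁ = 0) (h₂ : φ f₂ = 0) :
    ringKrullDim R + 1 + 1 ≤ ringKrullDim A := by
  have hp : (Ideal.span {f₁}).IsPrime := (Ideal.span_singleton_prime hf₁.ne_zero).2 hf₁
  let ψ : A ⧸ Ideal.span {f₁} →+* R := Ideal.Quotient.lift _ φ fun a ha => by
    obtain ⟨b, rfl⟩ := Ideal.mem_span_singleton.1 ha
    rw [map_mul, h₁, zero_mul]
  let g : A ⧸ Ideal.span {f₁} := Ideal.Quotient.mk _ f₂
  have hg : g ≠ 0 := fun hg =>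
    hf₂ (Ideal.mem_span_singleton.1 (Ideal.Quotient.eq_zero_iff_mem.1 hg))
  let χ : (A ⧸ Ideal.span {f₁}) ⧸ Ideal.span {g} →+* R := Ideal.Quotient.lift _ ψ fun a ha => by
    obtain ⟨b, rfl⟩ := Ideal.mem_span_singleton.1 ha
    rw [map_mul, show ψ g = 0 from h₂, zero_mul]
  have hχ : ringKrullDim R ≤ ringKrullDim ((A ⧸ Ideal.span {f₁}) ⧸ Ideal.span {g}) := by
    refine ringKrullDim_le_of_fractions χ fun r => ?_
    obtain ⟨a, d, hd, had⟩ := h r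
    exact ⟨Ideal.Quotient.mk _ (Ideal.Quotient.mk _ a), Ideal.Quotient.mk _ (Ideal.Quotient.mk _ d),
      hd, had⟩
  calc ringKrullDim R + 1 + 1
      ≤ ringKrullDim ((A ⧸ Ideal.span {f₁}) ⧸ Ideal.span {g}) + 1 + 1 := by gcongr
    _ ≤ ringKrullDim (A ⧸ Ideal.span {f₁}) + 1 := by
        gcongr
        exact ringKrullDim_quotient_succ_le_of_nonZeroDivisor (mem_nonZeroDivisors_of_ne_zero hg)
    _ ≤ ringKrullDim A :=
        ringKrullDim_quotient_succ_le_of_nonZeroDivisor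
          (mem_nonZeroDivisors_of_ne_zero hf₁.ne_zero)

/-- The polynomial `∑ i ∈ T, X i - 1` is prime if `T` is nonempty. -/
theorem prime_sum_X_sub_one {σ k : Type*} [Field k] {T : Finset σ} (hT : T.Nonempty) :
    Prime (∑ i ∈ T, MvPolynomial.X i - 1 : MvPolynomial σ k) := by
  classical
  obtain ⟨i₀, hi₀⟩ := hT
  let r : MvPolynomial σ k := ∑ i ∈ T.erase i₀, MvPolynomial.X i - 1
  have hr : (∑ i ∈ T, MvPolynomial.X i - 1 : MvPolynomial σ k) = MvPolynomial.X i₀ + r := by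
    rw [← Finset.add_sum_erase _ _ hi₀, add_sub_assoc]
  -- The shear `X i₀ ↦ X i₀ + ε r` fixes `r`, which does not involve `X i₀`. So `F 1` and `F (-1)`
  -- are mutually inverse, and `F 1` carries the prime `X i₀` to the given polynomial.
  let F (ε : MvPolynomial σ k) : MvPolynomial σ k →ₐ[k] MvPolynomial σ k :=
    MvPolynomial.aeval fun i => if i = i₀ then MvPolynomial.X i₀ + ε * r else MvPolynomial.X i
  have hFr : ∀ ε, F ε r = r := by
    intro ε
    simp only [r, map_sub, map_sum, map_one]
    congr 1
    refine Finset.sum_congr rfl fun i hi => ?_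
    simp [F, Finset.ne_of_mem_erase hi]
  have hF0 : ∀ ε, F ε (MvPolynomial.X i₀) = MvPolynomial.X i₀ + ε * r := by
    intro ε
    simp [F]
  have hF1 : ∀ ε i, i ≠ i₀ → F ε (MvPolynomial.X i) = MvPolynomial.X i := by
    intro ε i hi
    simp [F, hi]
  have hcomp1 : (F 1).comp (F (-1)) = AlgHom.id k _ := by
    ext1 i
    by_cases hi : i = i₀
    · subst hi
      simp [hF0, hFr]
    · simp [hF1 _ i hi]
  have hcomp2 : (F (-1)).comp (F 1) = AlgHom.id k _ := by
    ext1 i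
    by_cases hi : i = i₀
    · subst hi
      simp [hF0, hFr]
    · simp [hF1 _ i hi]
  let e : MvPolynomial σ k ≃ₐ[k] MvPolynomial σ k := AlgEquiv.ofAlgHom (F 1) (F (-1)) hcomp1 hcomp2
  have he : e (MvPolynomial.X i₀) = ∑ i ∈ T, MvPolynomial.X i - 1 := by
    rw [hr]
    exact (hF0 1).trans (by rw [one_mul])
  rw [← he]
  exact (MulEquiv.prime_iff e.toMulEquiv).2 MvPolynomial.X_prime

/-! ### Row sums, column sums and the cycle completion -/

variable {m n : ℕ} {S : Set (Fin m × Fin n)} {M : S → ℝ}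

/-- The block of a row. -/
def rowBlock (S : Set (Fin m × Fin n)) (i : Fin m) : Block S :=
  (graph S).connectedComponentMk (.inl i)

/-- The block of a column. -/
def colBlock (S : Set (Fin m × Fin n)) (j : Fin n) : Block S :=
  (graph S).connectedComponentMk (.inr j)

/-- The sum of the `i`-th row of `A`. -/
def rowSum (A : Matrix (Fin m) (Fin n) ℝ) (i : Fin m) : ℝ := ∑ j, A i j

/-- The sum of the `j`-th column of `A`. -/
def colSum (A : Matrix (Fin m) (Fin n) ℝ) (j : Fin n) : ℝ := ∑ i, A i j

open scoped Classical in
/-- The sum of the rows of `A` belonging to the block `c`. -/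
def rowMass (A : Matrix (Fin m) (Fin n) ℝ) (c : Block S) : ℝ :=
  ∑ i with rowBlock S i = c, rowSum A i

open scoped Classical in
/-- The sum of the columns of `A` belonging to the block `c`. -/
def colMass (A : Matrix (Fin m) (Fin n) ℝ) (c : Block S) : ℝ :=
  ∑ j with colBlock S j = c, colSum A j

/-- The column space is spanned by one vector, so all columns are multiples of it. -/
theorem minor_eq_of_rank_eq_one {A : Matrix (Fin m) (Fin n) ℝ} (h : A.rank = 1)
    (i k : Fin m) (j l : Fin n) : A i j * A k l = A i l * A k j := by
  obtain ⟨v, hv⟩ := finrank_le_one_iff.1 (le_of_eq h)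
  have key : ∀ j, ∃ c : ℝ, ∀ i, A i j = c * v.1 i := by
    intro j
    obtain ⟨c, hc⟩ := hv ⟨A.mulVecLin (Pi.single j 1), LinearMap.mem_range_self _ _⟩
    refine ⟨c, fun i => ?_⟩
    have := congrFun (congrArg Subtype.val hc) i
    simpa using this.symm
  obtain ⟨c, hc⟩ := key j
  obtain ⟨d, hd⟩ := key l
  rw [hc, hc, hd, hd]
  ring

/-- Sum the minor identity over `k` and `l` and use that the total is `1`. -/
theorem eq_rowSum_mul_colSum {A : Matrix (Fin m) (Fin n) ℝ}
    (h : ∀ i k j l, A i j * A k l = A i l * A k j) (hsum : ∑ k, ∑ l, A k l = 1)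
    (i : Fin m) (j : Fin n) : A i j = rowSum A i * colSum A j := by
  rw [rowSum, colSum, Finset.sum_mul_sum, Finset.sum_comm, ← mul_one (A i j), ← hsum,
    Finset.mul_sum]
  refine Finset.sum_congr rfl fun k _ => ?_
  rw [Finset.mul_sum]
  exact Finset.sum_congr rfl fun l _ => h i k j l

theorem rank_eq_one_of_minor_eq {A : Matrix (Fin m) (Fin n) ℝ}
    (h : ∀ i k j l, A i j * A k l = A i l * A k j) (hsum : ∑ k, ∑ l, A k l = 1) :
    A.rank = 1 := by
  have hA : A = Matrix.vecMulVec (rowSum A) (colSum A) := by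
    ext i j
    rw [Matrix.vecMulVec_apply]
    exact eq_rowSum_mul_colSum h hsum i j
  refine le_antisymm ?_ (Nat.one_le_iff_ne_zero.2 fun h0 => ?_)
  · rw [hA]
    exact Matrix.rank_vecMulVec_le _ _
  · rw [Matrix.rank, Submodule.finrank_eq_zero, LinearMap.range_eq_bot] at h0
    have hA0 : A = 0 := by
      ext i j
      simpa using congrFun (LinearMap.congr_fun h0 (Pi.single j 1)) i
    simp [hA0] at hsum

/-- The completions are the matrices with vanishing two-minors in the simplex with the specified
entries. -/
theorem mem_completions_iff {A : Matrix (Fin m) (Fin n) ℝ} :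
    A ∈ completions M ↔ (∀ i k j l, A i j * A k l = A i l * A k j) ∧ (∀ i j, 0 ≤ A i j) ∧
      ∑ k, ∑ l, A k l = 1 ∧ ∀ e : S, A e.1.1 e.1.2 = M e := by
  have hs : Function.uncurry A ∈ stdSimplex ℝ (Fin m × Fin n) ↔
      (∀ i j, 0 ≤ A i j) ∧ ∑ k, ∑ l, A k l = 1 := by
    simp [stdSimplex, Fintype.sum_prod_type, Function.uncurry]
  constructor
  · rintro ⟨h1, h2, h3⟩
    exact ⟨minor_eq_of_rank_eq_one h1, (hs.1 h2).1, (hs.1 h2).2, h3⟩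
  · rintro ⟨h1, h2, h3, h4⟩
    exact ⟨rank_eq_one_of_minor_eq h1 h3, hs.2 ⟨h2, h3⟩, h4⟩

section completion

variable {A : Matrix (Fin m) (Fin n) ℝ}

theorem apply_eq_of_mem_completions (hA : A ∈ completions M) (i : Fin m) (j : Fin n) :
    A i j = rowSum A i * colSum A j :=
  have h := mem_completions_iff.1 hA
  eq_rowSum_mul_colSum h.1 h.2.2.1 i j

theorem rowSum_nonneg (hA : A ∈ completions M) (i : Fin m) : 0 ≤ rowSum A i :=
  Finset.sum_nonneg fun j _ => (mem_completions_iff.1 hA).2.1 i j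

theorem colSum_nonneg (hA : A ∈ completions M) (j : Fin n) : 0 ≤ colSum A j :=
  Finset.sum_nonneg fun i _ => (mem_completions_iff.1 hA).2.1 i j

theorem apply_pos_of_mem (hpos : ∀ e : S, 0 < M e) (hA : A ∈ completions M) {i : Fin m} {j : Fin n}
    (h : (i, j) ∈ S) : 0 < A i j := by
  rw [(mem_completions_iff.1 hA).2.2.2 ⟨(i, j), h⟩]
  exact hpos _

theorem rowSum_pos_of_mem (hpos : ∀ e : S, 0 < M e) (hA : A ∈ completions M) {i : Fin m}
    {j : Fin n} (h : (i, j) ∈ S) : 0 < rowSum A i := by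
  have := apply_pos_of_mem hpos hA h
  rw [apply_eq_of_mem_completions hA] at this
  exact pos_of_mul_pos_left this (colSum_nonneg hA j)

theorem colSum_pos_of_mem (hpos : ∀ e : S, 0 < M e) (hA : A ∈ completions M) {i : Fin m}
    {j : Fin n} (h : (i, j) ∈ S) : 0 < colSum A j := by
  have := apply_pos_of_mem hpos hA h
  rw [apply_eq_of_mem_completions hA] at this
  exact pos_of_mul_pos_right this (rowSum_nonneg hA i)

theorem exists_adj_of_reachable_of_ne {V : Type*} {G : SimpleGraph V} {u v : V}
    (h : G.Reachable u v) (hne : u ≠ v) : ∃ w, G.Adj u w := by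
  obtain ⟨p⟩ := h
  cases p with
  | nil => exact absurd rfl hne
  | cons h _ => exact ⟨_, h⟩

theorem exists_mem_of_row_reachable {i : Fin m} {v : Fin m ⊕ Fin n}
    (h : (graph S).Reachable (.inl i) v) (hne : .inl i ≠ v) : ∃ j, (i, j) ∈ S := by
  obtain ⟨k | j, hw⟩ := exists_adj_of_reachable_of_ne h hne
  · exact hw.elim
  · exact ⟨j, hw⟩

theorem exists_mem_of_col_reachable {j : Fin n} {v : Fin m ⊕ Fin n}
    (h : (graph S).Reachable (.inr j) v) (hne : .inr j ≠ v) : ∃ i, (i, j) ∈ S := by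
  obtain ⟨i | l, hw⟩ := exists_adj_of_reachable_of_ne h hne
  · exact ⟨i, hw⟩
  · exact hw.elim

theorem entry_eq_of_mem_completions (hA : A ∈ completions M) {i : Fin m} {j : Fin n}
    (h : (i, j) ∈ S) : entry M i j = rowSum A i * colSum A j := by
  rw [entry, dif_pos h, ← apply_eq_of_mem_completions hA]
  exact ((mem_completions_iff.1 hA).2.2.2 ⟨(i, j), h⟩).symm

/-- Each weight is a row sum times a column sum, so the quotient telescopes to the two endpoints. A
walk starting at a column has even length and leaves a ratio of column sums; this second case is
what the induction needs. The endpoint is a variable `w` so that the induction can run on the walk.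
-/
theorem altQuotient_eq (hpos : ∀ e : S, 0 < M e) (hA : A ∈ completions M) {j : Fin n}
    (hj : colSum A j ≠ 0) {s w : Fin m ⊕ Fin n} (p : (graph S).Walk s w) (hw : w = .inr j) :
    altQuotient M p =
      Sum.elim (fun i => rowSum A i * colSum A j) (fun l => colSum A l / colSum A j) s := by
  induction p with
  | nil =>
    subst hw
    simp [altQuotient, hj]
  | @cons a b c h p ih =>
    rw [altQuotient, ih hw]
    rcases a with i | l <;> rcases b with k | t
    · exact h.elim
    · have ht : (i, t) ∈ S := h
      have := (colSum_pos_of_mem hpos hA ht).ne'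
      simp only [weight, Sum.elim_inl, Sum.elim_inr, entry_eq_of_mem_completions hA ht]
      field_simp
    · have ht : (k, l) ∈ S := h
      have := (rowSum_pos_of_mem hpos hA ht).ne'
      simp only [weight, Sum.elim_inl, Sum.elim_inr, entry_eq_of_mem_completions hA ht]
      field_simp
    · exact h.elim

/-- Every completion extends the completion along cycles. -/
theorem cycleCompletion_eq (hpos : ∀ e : S, 0 < M e) (hA : A ∈ completions M)
    (e : closurePattern S) : cycleCompletion M e = rowSum A e.1.1 * colSum A e.1.2 := by
  rw [cycleCompletion]
  split_ifs with h
  · rw [← apply_eq_of_mem_completions hA]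
    exact ((mem_completions_iff.1 hA).2.2.2 ⟨e.1, h⟩).symm
  · have he : (graph S).Reachable (.inl e.1.1) (.inr e.1.2) := e.2
    obtain ⟨i, hi⟩ := exists_mem_of_col_reachable he.symm (by simp)
    exact altQuotient_eq hpos hA (colSum_pos_of_mem hpos hA hi).ne' _ rfl

/-- The closure pattern contains every row-column pair of the block, so the sum of the products
factors. -/
theorem blockSum_eq (hpos : ∀ e : S, 0 < M e) (hA : A ∈ completions M) (c : Block S) :
    blockSum M c = rowMass A c * colMass A c := by
  classical
  rw [blockSum, rowMass, colMass, Finset.sum_mul_sum, ← Finset.sum_product']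
  refine Finset.sum_bij (fun e _ => e.1) ?_ (fun _ _ _ _ h => Subtype.ext h) ?_
    (fun e _ => cycleCompletion_eq hpos hA e)
  · intro e he
    have h1 := (Finset.mem_filter.1 he).2
    have h2 : colBlock S e.1.2 = rowBlock S e.1.1 :=
      (SimpleGraph.ConnectedComponent.eq.2 e.2).symm
    rw [Finset.mem_product, Finset.mem_filter, Finset.mem_filter]
    exact ⟨⟨Finset.mem_univ _, h1⟩, Finset.mem_univ _, h2.trans h1⟩
  · rintro ⟨i, j⟩ he
    rw [Finset.mem_product, Finset.mem_filter, Finset.mem_filter] at he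
    exact ⟨⟨(i, j), SimpleGraph.ConnectedComponent.eq.1 (he.1.2.trans he.2.2.symm)⟩,
      Finset.mem_filter.2 ⟨Finset.mem_univ _, he.1.2⟩, rfl⟩

end completion

/-! ### Parametrization by block masses -/

/-- The masses which a completion of `M` can place on the rows and on the columns of the blocks. -/
structure IsBlockMass (M : S → ℝ) (p q : Block S → ℝ) : Prop where
  row_nonneg : ∀ c, 0 ≤ p c
  col_nonneg : ∀ c, 0 ≤ q c
  sum_row : ∑ c, p c = 1
  sum_col : ∑ c, q c = 1
  mul_eq : ∀ c, p c * q c = blockSum M c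
  row_eq_zero : ∀ c, (∀ i, rowBlock S i ≠ c) → p c = 0
  col_eq_zero : ∀ c, (∀ j, colBlock S j ≠ c) → q c = 0

theorem isBlockMass_of_mem_completions (hpos : ∀ e : S, 0 < M e) {A : Matrix (Fin m) (Fin n) ℝ}
    (hA : A ∈ completions M) : IsBlockMass M (rowMass A) (colMass A) where
  row_nonneg c := Finset.sum_nonneg fun i _ => rowSum_nonneg hA i
  col_nonneg c := Finset.sum_nonneg fun j _ => colSum_nonneg hA j
  sum_row := by
    classical
    exact (Finset.sum_fiberwise _ (rowBlock S) (rowSum A)).trans (mem_completions_iff.1 hA).2.2.1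
  sum_col := by
    classical
    refine (Finset.sum_fiberwise _ (colBlock S) (colSum A)).trans ?_
    simp only [colSum]
    rw [Finset.sum_comm]
    exact (mem_completions_iff.1 hA).2.2.1
  mul_eq c := (blockSum_eq hpos hA c).symm
  row_eq_zero c hc := by
    classical
    exact Finset.sum_eq_zero fun i hi => absurd (Finset.mem_filter.1 hi).2 (hc i)
  col_eq_zero c hc := by
    classical
    exact Finset.sum_eq_zero fun j hj => absurd (Finset.mem_filter.1 hj).2 (hc j)

/-- The share of the `i`-th row of `A` in the rows of its block (with the value `1` if these rows
vanish). -/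
def rowShare (S : Set (Fin m × Fin n)) (A : Matrix (Fin m) (Fin n) ℝ) (i : Fin m) : ℝ :=
  if rowMass A (rowBlock S i) = 0 then 1 else rowSum A i / rowMass A (rowBlock S i)

/-- The share of the `j`-th column of `A` in the columns of its block (with the value `1` if these
columns vanish). -/
def colShare (S : Set (Fin m × Fin n)) (A : Matrix (Fin m) (Fin n) ℝ) (j : Fin n) : ℝ :=
  if colMass A (colBlock S j) = 0 then 1 else colSum A j / colMass A (colBlock S j)

section share

variable {A B : Matrix (Fin m) (Fin n) ℝ}

theorem rowSum_le_rowMass (hA : A ∈ completions M) (i : Fin m) :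
    rowSum A i ≤ rowMass A (rowBlock S i) := by
  classical
  exact Finset.single_le_sum (f := rowSum A) (fun k _ => rowSum_nonneg hA k)
    (Finset.mem_filter.2 ⟨Finset.mem_univ i, rfl⟩)

theorem colSum_le_colMass (hA : A ∈ completions M) (j : Fin n) :
    colSum A j ≤ colMass A (colBlock S j) := by
  classical
  exact Finset.single_le_sum (f := colSum A) (fun k _ => colSum_nonneg hA k)
    (Finset.mem_filter.2 ⟨Finset.mem_univ j, rfl⟩)

/-- A row without mass in its block is alone in its block. -/
theorem rowBlock_inj_of_rowMass_eq_zero (hpos : ∀ e : S, 0 < M e) (hA : A ∈ completions M)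
    {i k : Fin m} (h0 : rowMass A (rowBlock S i) = 0) (hk : rowBlock S k = rowBlock S i) :
    k = i := by
  by_contra hne
  -- A second row in the block would meet an edge and so have positive sum.
  obtain ⟨j, hj⟩ := exists_mem_of_row_reachable (SimpleGraph.ConnectedComponent.eq.1 hk)
    (fun h => hne (Sum.inl_injective h))
  have := rowSum_pos_of_mem hpos hA hj
  have := rowSum_le_rowMass hA k
  rw [hk] at this
  linarith

theorem colBlock_inj_of_colMass_eq_zero (hpos : ∀ e : S, 0 < M e) (hA : A ∈ completions M)
    {j l : Fin n} (h0 : colMass A (colBlock S j) = 0) (hl : colBlock S l = colBlock S j) :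
    l = j := by
  by_contra hne
  obtain ⟨i, hi⟩ := exists_mem_of_col_reachable (SimpleGraph.ConnectedComponent.eq.1 hl)
    (fun h => hne (Sum.inr_injective h))
  have := colSum_pos_of_mem hpos hA hi
  have := colSum_le_colMass hA l
  rw [hl] at this
  linarith

theorem filter_rowBlock_of_rowMass_eq_zero (hpos : ∀ e : S, 0 < M e) (hA : A ∈ completions M)
    {i : Fin m} (h0 : rowMass A (rowBlock S i) = 0) [DecidableEq (Block S)] :
    ({k | rowBlock S k = rowBlock S i} : Finset (Fin m)) = {i} := by
  ext k
  rw [Finset.mem_filter, Finset.mem_singleton]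
  exact ⟨fun h => rowBlock_inj_of_rowMass_eq_zero hpos hA h0 h.2,
    fun h => ⟨Finset.mem_univ _, by rw [h]⟩⟩

theorem filter_colBlock_of_colMass_eq_zero (hpos : ∀ e : S, 0 < M e) (hA : A ∈ completions M)
    {j : Fin n} (h0 : colMass A (colBlock S j) = 0) [DecidableEq (Block S)] :
    ({k | colBlock S k = colBlock S j} : Finset (Fin n)) = {j} := by
  ext k
  rw [Finset.mem_filter, Finset.mem_singleton]
  exact ⟨fun h => colBlock_inj_of_colMass_eq_zero hpos hA h0 h.2,
    fun h => ⟨Finset.mem_univ _, by rw [h]⟩⟩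

/-- For a column `j` adjacent to row `i`, both completions agree at `(i, j)` and `(k, j)`;
eliminating the positive column sums leaves equal ratios, stated without division because row sums
may vanish. -/
theorem rowSum_mul_rowSum (hpos : ∀ e : S, 0 < M e) (hA : A ∈ completions M)
    (hB : B ∈ completions M) {i k : Fin m} (h : rowBlock S i = rowBlock S k) :
    rowSum B i * rowSum A k = rowSum A i * rowSum B k := by
  rcases eq_or_ne i k with rfl | hne
  · ring
  have hr : (graph S).Reachable (.inl i) (.inl k) := SimpleGraph.ConnectedComponent.eq.1 h
  obtain ⟨j, hj⟩ := exists_mem_of_row_reachable hr (fun h => hne (Sum.inl_injective h))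
  have hij : (graph S).Adj (.inl i) (.inr j) := hj
  have hkj : (k, j) ∈ closurePattern S := hr.symm.trans hij.reachable
  have hA0 := (colSum_pos_of_mem hpos hA hj).ne'
  have hB0 := (colSum_pos_of_mem hpos hB hj).ne'
  have e1 := (cycleCompletion_eq hpos hA ⟨(i, j), hij.reachable⟩).symm.trans
    (cycleCompletion_eq hpos hB ⟨(i, j), hij.reachable⟩)
  have e2 := (cycleCompletion_eq hpos hA ⟨(k, j), hkj⟩).symm.trans
    (cycleCompletion_eq hpos hB ⟨(k, j), hkj⟩)
  simp only at e1 e2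
  refine mul_right_cancel₀ (mul_ne_zero hA0 hB0) ?_
  linear_combination (rowSum B i * colSum B j) * e2 - (rowSum B k * colSum B j) * e1

theorem colSum_mul_colSum (hpos : ∀ e : S, 0 < M e) (hA : A ∈ completions M)
    (hB : B ∈ completions M) {j l : Fin n} (h : colBlock S j = colBlock S l) :
    colSum B j * colSum A l = colSum A j * colSum B l := by
  rcases eq_or_ne j l with rfl | hne
  · ring
  have hr : (graph S).Reachable (.inr j) (.inr l) := SimpleGraph.ConnectedComponent.eq.1 h
  obtain ⟨i, hi⟩ := exists_mem_of_col_reachable hr (fun h => hne (Sum.inr_injective h))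
  have hij : (graph S).Adj (.inl i) (.inr j) := hi
  have hil : (i, l) ∈ closurePattern S := hij.reachable.trans hr
  have hA0 := (rowSum_pos_of_mem hpos hA hi).ne'
  have hB0 := (rowSum_pos_of_mem hpos hB hi).ne'
  have e1 := (cycleCompletion_eq hpos hA ⟨(i, j), hij.reachable⟩).symm.trans
    (cycleCompletion_eq hpos hB ⟨(i, j), hij.reachable⟩)
  have e2 := (cycleCompletion_eq hpos hA ⟨(i, l), hil⟩).symm.trans
    (cycleCompletion_eq hpos hB ⟨(i, l), hil⟩)
  simp only at e1 e2
  refine mul_right_cancel₀ (mul_ne_zero hA0 hB0) ?_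
  linear_combination (rowSum B i * colSum B j) * e2 - (rowSum B i * colSum B l) * e1

/-- The shares are the same for all completions. -/
theorem rowSum_eq_rowShare_mul (hpos : ∀ e : S, 0 < M e) (hA : A ∈ completions M)
    (hB : B ∈ completions M) (i : Fin m) :
    rowSum B i = rowShare S A i * rowMass B (rowBlock S i) := by
  classical
  rw [rowShare]
  split_ifs with h0
  -- A row block without mass in `A` is a single row, which may have mass in `B`; the default share
  -- `1` is exactly right there.
  · rw [one_mul, rowMass, filter_rowBlock_of_rowMass_eq_zero hpos hA h0, Finset.sum_singleton]
  · rw [div_mul_eq_mul_div, eq_div_iff h0, rowMass, rowMass, Finset.mul_sum, Finset.mul_sum]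
    exact Finset.sum_congr rfl fun k hk =>
      rowSum_mul_rowSum hpos hA hB (Finset.mem_filter.1 hk).2.symm

theorem colSum_eq_colShare_mul (hpos : ∀ e : S, 0 < M e) (hA : A ∈ completions M)
    (hB : B ∈ completions M) (j : Fin n) :
    colSum B j = colShare S A j * colMass B (colBlock S j) := by
  classical
  rw [colShare]
  split_ifs with h0
  · rw [one_mul, colMass, filter_colBlock_of_colMass_eq_zero hpos hA h0, Finset.sum_singleton]
  · rw [div_mul_eq_mul_div, eq_div_iff h0, colMass, colMass, Finset.mul_sum, Finset.mul_sum]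
    exact Finset.sum_congr rfl fun k hk =>
      colSum_mul_colSum hpos hA hB (Finset.mem_filter.1 hk).2.symm

theorem rowShare_nonneg (hA : A ∈ completions M) (i : Fin m) : 0 ≤ rowShare S A i := by
  rw [rowShare]
  split_ifs
  · exact zero_le_one
  · exact div_nonneg (rowSum_nonneg hA i)
      ((rowSum_nonneg hA i).trans (rowSum_le_rowMass hA i))

theorem colShare_nonneg (hA : A ∈ completions M) (j : Fin n) : 0 ≤ colShare S A j := by
  rw [colShare]
  split_ifs
  · exact zero_le_one
  · exact div_nonneg (colSum_nonneg hA j)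
      ((colSum_nonneg hA j).trans (colSum_le_colMass hA j))

open scoped Classical in
theorem sum_rowShare (hpos : ∀ e : S, 0 < M e) (hA : A ∈ completions M) (i : Fin m) :
    ∑ k with rowBlock S k = rowBlock S i, rowShare S A k = 1 := by
  by_cases h0 : rowMass A (rowBlock S i) = 0
  · rw [filter_rowBlock_of_rowMass_eq_zero hpos hA h0, Finset.sum_singleton, rowShare, if_pos h0]
  · have : ∀ k ∈ ({k | rowBlock S k = rowBlock S i} : Finset (Fin m)),
        rowShare S A k = rowSum A k / rowMass A (rowBlock S i) := by
      intro k hk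
      rw [rowShare, (Finset.mem_filter.1 hk).2, if_neg h0]
    rw [Finset.sum_congr rfl this, ← Finset.sum_div]
    exact div_self h0

open scoped Classical in
theorem sum_colShare (hpos : ∀ e : S, 0 < M e) (hA : A ∈ completions M) (j : Fin n) :
    ∑ k with colBlock S k = colBlock S j, colShare S A k = 1 := by
  by_cases h0 : colMass A (colBlock S j) = 0
  · rw [filter_colBlock_of_colMass_eq_zero hpos hA h0, Finset.sum_singleton, colShare, if_pos h0]
  · have : ∀ k ∈ ({k | colBlock S k = colBlock S j} : Finset (Fin n)),
        colShare S A k = colSum A k / colMass A (colBlock S j) := by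
      intro k hk
      rw [colShare, (Finset.mem_filter.1 hk).2, if_neg h0]
    rw [Finset.sum_congr rfl this, ← Finset.sum_div]
    exact div_self h0

/-- The matrix with prescribed block masses and with the same shares as `A`. -/
def ofMass (A : Matrix (Fin m) (Fin n) ℝ) (p q : Block S → ℝ) : Matrix (Fin m) (Fin n) ℝ :=
  fun i j => (rowShare S A i * p (rowBlock S i)) * (colShare S A j * q (colBlock S j))

open scoped Classical in
theorem sum_rowShare_mul_block (hpos : ∀ e : S, 0 < M e) (hA : A ∈ completions M)
    {p q : Block S → ℝ} (h : IsBlockMass M p q) (c : Block S) :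
    ∑ i with rowBlock S i = c, rowShare S A i * p (rowBlock S i) = p c := by
  by_cases hc : ∃ i, rowBlock S i = c
  · obtain ⟨i, rfl⟩ := hc
    calc ∑ k with rowBlock S k = rowBlock S i, rowShare S A k * p (rowBlock S k)
        = ∑ k with rowBlock S k = rowBlock S i, rowShare S A k * p (rowBlock S i) :=
          Finset.sum_congr rfl fun k hk => by rw [(Finset.mem_filter.1 hk).2]
      _ = p (rowBlock S i) := by rw [← Finset.sum_mul, sum_rowShare hpos hA, one_mul]
  · push Not at hc
    rw [h.row_eq_zero c hc]
    exact Finset.sum_eq_zero fun i hi => absurd (Finset.mem_filter.1 hi).2 (hc i)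

open scoped Classical in
theorem sum_colShare_mul_block (hpos : ∀ e : S, 0 < M e) (hA : A ∈ completions M)
    {p q : Block S → ℝ} (h : IsBlockMass M p q) (c : Block S) :
    ∑ j with colBlock S j = c, colShare S A j * q (colBlock S j) = q c := by
  by_cases hc : ∃ j, colBlock S j = c
  · obtain ⟨j, rfl⟩ := hc
    calc ∑ k with colBlock S k = colBlock S j, colShare S A k * q (colBlock S k)
        = ∑ k with colBlock S k = colBlock S j, colShare S A k * q (colBlock S j) :=
          Finset.sum_congr rfl fun k hk => by rw [(Finset.mem_filter.1 hk).2]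
      _ = q (colBlock S j) := by rw [← Finset.sum_mul, sum_colShare hpos hA, one_mul]
  · push Not at hc
    rw [h.col_eq_zero c hc]
    exact Finset.sum_eq_zero fun j hj => absurd (Finset.mem_filter.1 hj).2 (hc j)

theorem sum_rowShare_mul (hpos : ∀ e : S, 0 < M e) (hA : A ∈ completions M)
    {p q : Block S → ℝ} (h : IsBlockMass M p q) :
    ∑ i, rowShare S A i * p (rowBlock S i) = 1 := by
  classical
  rw [← h.sum_row, ← Finset.sum_fiberwise _ (rowBlock S)]
  exact Finset.sum_congr rfl fun c _ => sum_rowShare_mul_block hpos hA h c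

theorem sum_colShare_mul (hpos : ∀ e : S, 0 < M e) (hA : A ∈ completions M)
    {p q : Block S → ℝ} (h : IsBlockMass M p q) :
    ∑ j, colShare S A j * q (colBlock S j) = 1 := by
  classical
  rw [← h.sum_col, ← Finset.sum_fiberwise _ (colBlock S)]
  exact Finset.sum_congr rfl fun c _ => sum_colShare_mul_block hpos hA h c

theorem rowSum_ofMass (hpos : ∀ e : S, 0 < M e) (hA : A ∈ completions M)
    {p q : Block S → ℝ} (h : IsBlockMass M p q) (i : Fin m) :
    rowSum (ofMass A p q) i = rowShare S A i * p (rowBlock S i) := by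
  simp only [rowSum, ofMass]
  rw [← Finset.mul_sum, sum_colShare_mul hpos hA h, mul_one]

theorem colSum_ofMass (hpos : ∀ e : S, 0 < M e) (hA : A ∈ completions M)
    {p q : Block S → ℝ} (h : IsBlockMass M p q) (j : Fin n) :
    colSum (ofMass A p q) j = colShare S A j * q (colBlock S j) := by
  simp only [colSum, ofMass]
  rw [← Finset.sum_mul, sum_rowShare_mul hpos hA h, one_mul]

theorem rowMass_ofMass (hpos : ∀ e : S, 0 < M e) (hA : A ∈ completions M)
    {p q : Block S → ℝ} (h : IsBlockMass M p q) : rowMass (ofMass A p q) = p := by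
  funext c
  simp only [rowMass, rowSum_ofMass hpos hA h]
  exact sum_rowShare_mul_block hpos hA h c

theorem colMass_ofMass (hpos : ∀ e : S, 0 < M e) (hA : A ∈ completions M)
    {p q : Block S → ℝ} (h : IsBlockMass M p q) : colMass (ofMass A p q) = q := by
  funext c
  simp only [colMass, colSum_ofMass hpos hA h]
  exact sum_colShare_mul_block hpos hA h c

theorem ofMass_mem_completions (hpos : ∀ e : S, 0 < M e) (hA : A ∈ completions M)
    {p q : Block S → ℝ} (h : IsBlockMass M p q) : ofMass A p q ∈ completions M := by
  rw [mem_completions_iff]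
  refine ⟨fun i k j l => ?_, fun i j => ?_, ?_, ?_⟩
  · simp only [ofMass]
    ring
  · exact mul_nonneg (mul_nonneg (rowShare_nonneg hA i) (h.row_nonneg _))
      (mul_nonneg (colShare_nonneg hA j) (h.col_nonneg _))
  · simp only [ofMass]
    rw [← Finset.sum_mul_sum, sum_rowShare_mul hpos hA h, sum_colShare_mul hpos hA h, one_mul]
  · rintro ⟨⟨i, j⟩, he⟩
    have hadj : (graph S).Adj (.inl i) (.inr j) := he
    have hb : rowBlock S i = colBlock S j :=
      SimpleGraph.ConnectedComponent.eq.2 hadj.reachable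
    -- Specified entries depend on the masses only through `p c * q c`, which is the same block sum
    -- for `A`.
    have h1 := (h.mul_eq (colBlock S j)).trans (blockSum_eq hpos hA (colBlock S j))
    rw [← (mem_completions_iff.1 hA).2.2.2 ⟨(i, j), he⟩]
    simp only
    rw [apply_eq_of_mem_completions hA, rowSum_eq_rowShare_mul hpos hA hA i,
      colSum_eq_colShare_mul hpos hA hA j, hb]
    simp only [ofMass]
    rw [hb]
    linear_combination (rowShare S A i * colShare S A j) * h1

theorem ofMass_rowMass_colMass (hpos : ∀ e : S, 0 < M e) (hA : A ∈ completions M)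
    (hB : B ∈ completions M) :
    ofMass A (rowMass B : Block S → ℝ) (colMass B) = B := by
  ext i j
  rw [apply_eq_of_mem_completions hB, rowSum_eq_rowShare_mul hpos hA hB i,
      colSum_eq_colShare_mul hpos hA hB j]
  rfl

end share

/-- The completions are parametrized by the block masses. -/
theorem bijOn_completions (hpos : ∀ e : S, 0 < M e) (hM : Completable M) :
    Set.BijOn (fun A => ((rowMass A, colMass A) : (Block S → ℝ) × (Block S → ℝ)))
      (completions M) {x | IsBlockMass M x.1 x.2} := by
  obtain ⟨A, hA⟩ := hM
  refine ⟨fun B hB => isBlockMass_of_mem_completions hpos hB, fun B hB C hC h => ?_, ?_⟩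
  · rw [← ofMass_rowMass_colMass hpos hA hB, ← ofMass_rowMass_colMass hpos hA hC,
      show rowMass B = rowMass C from (Prod.ext_iff.1 h).1,
      show colMass B = colMass C from (Prod.ext_iff.1 h).2]
  · rintro ⟨p, q⟩ h
    exact ⟨ofMass A p q, ofMass_mem_completions hpos hA h,
      Prod.ext (rowMass_ofMass hpos hA h) (colMass_ofMass hpos hA h)⟩

/-! ### Cases with a unique completion -/

theorem existsUnique_completion (hpos : ∀ e : S, 0 < M e) (hM : Completable M)
    (h : ∀ p q p' q', IsBlockMass M p q → IsBlockMass M p' q' → p = p' ∧ q = q') :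
    ∃! A : Matrix (Fin m) (Fin n) ℝ, A ∈ completions M := by
  obtain ⟨A, hA⟩ := hM
  refine ⟨A, hA, fun B hB => (bijOn_completions hpos ⟨A, hA⟩).injOn hB hA ?_⟩
  obtain ⟨h1, h2⟩ := h _ _ _ _ (isBlockMass_of_mem_completions hpos hB)
    (isBlockMass_of_mem_completions hpos hA)
  exact Prod.ext h1 h2

/-- This is the equality case of Cauchy–Schwarz: the squares `(√p - √q)²` sum to `2 - 2 ∑ √b = 0`.
-/
theorem IsBlockMass.eq_sqrt {p q : Block S → ℝ} (h : IsBlockMass M p q)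
    (hb : ∑ c, √(blockSum M c) = 1) : (p = fun c => √(blockSum M c)) ∧ q = p := by
  have h0 : ∑ c, (√(p c) - √(q c)) ^ 2 = 0 := by
    have : ∀ c, (√(p c) - √(q c)) ^ 2 = p c + q c - 2 * √(blockSum M c) := by
      intro c
      rw [← h.mul_eq, Real.sqrt_mul (h.row_nonneg c)]
      have h1 := Real.sq_sqrt (h.row_nonneg c)
      have h2 := Real.sq_sqrt (h.col_nonneg c)
      linear_combination h1 + h2
    rw [Finset.sum_congr rfl fun c _ => this c, Finset.sum_sub_distrib, Finset.sum_add_distrib,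
      ← Finset.mul_sum, h.sum_row, h.sum_col, hb]
    norm_num
  have hpq : ∀ c, p c = q c := by
    intro c
    have h1 := (Finset.sum_eq_zero_iff_of_nonneg (fun c _ => sq_nonneg _)).1 h0 c
      (Finset.mem_univ c)
    exact (Real.sqrt_inj (h.row_nonneg c) (h.col_nonneg c)).1
      (sub_eq_zero.1 (pow_eq_zero_iff two_ne_zero |>.1 h1))
  refine ⟨funext fun c => ?_, funext fun c => (hpq c).symm⟩
  rw [← h.mul_eq, ← hpq c, Real.sqrt_mul_self (h.row_nonneg c)]

theorem existsUnique_completion_of_sum_sqrt_eq_one (hpos : ∀ e : S, 0 < M e) (hM : Completable M)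
    (hb : ∑ c, √(blockSum M c) = 1) :
    ∃! A : Matrix (Fin m) (Fin n) ℝ, A ∈ completions M :=
  existsUnique_completion hpos hM fun p q p' q' h h' => by
    obtain ⟨h1, rfl⟩ := h.eq_sqrt hb
    obtain ⟨h2, rfl⟩ := h'.eq_sqrt hb
    exact ⟨h1.trans h2.symm, h1.trans h2.symm⟩

/-- If there are two blocks, sums over the blocks have two terms. -/
theorem exists_sum_eq_of_card_eq_two {α : Type*} [Fintype α] (h : Fintype.card α = 2) (c : α) :
    ∃ d, d ≠ c ∧ (∀ x, x = c ∨ x = d) ∧ ∀ f : α → ℝ, ∑ x, f x = f c + f d := by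
  classical
  obtain ⟨a, b, hab, hu⟩ := Finset.card_eq_two.1 (Finset.card_univ.trans h)
  have hmem : ∀ x, x = a ∨ x = b := fun x => by
    have := Finset.mem_univ x
    rw [hu] at this
    simpa using this
  have hsum : ∀ f : α → ℝ, ∑ x, f x = f a + f b := fun f => by
    rw [hu, Finset.sum_pair hab]
  rcases hmem c with rfl | rfl
  · exact ⟨b, hab.symm, hmem, hsum⟩
  · exact ⟨a, hab, fun x => (hmem x).symm, fun f => (hsum f).trans (add_comm _ _)⟩

theorem IsBlockMass.eq_zero_or_eq_zero {p q : Block S → ℝ} (h : IsBlockMass M p q) {c : Block S}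
    {v : Fin m ⊕ Fin n} (hc : c.supp = {v}) :
    (v.isLeft → q c = 0) ∧ (v.isRight → p c = 0) := by
  have hmem : ∀ w, (graph S).connectedComponentMk w = c → w = v := fun w hw => by
    have : w ∈ c.supp := hw
    rwa [hc] at this
  constructor
  · intro hv
    refine h.col_eq_zero c fun j hj => ?_
    rw [← hmem _ hj] at hv
    simp at hv
  · intro hv
    refine h.row_eq_zero c fun i hi => ?_
    rw [← hmem _ hi] at hv
    simp at hv

/-- An isolated row has no column mass, so the other block has column mass `1` and its row mass
equals its block sum; the sum conditions fix the rest. An isolated column is symmetric. -/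
theorem existsUnique_completion_of_isIsolatedVertex (hpos : ∀ e : S, 0 < M e) (hM : Completable M)
    (hcard : Fintype.card (Block S) = 2) {c : Block S} (hc : IsIsolatedVertex c) :
    ∃! A : Matrix (Fin m) (Fin n) ℝ, A ∈ completions M := by
  obtain ⟨v, hv⟩ := hc
  obtain ⟨d, -, hd, hsum⟩ := exists_sum_eq_of_card_eq_two hcard c
  refine existsUnique_completion hpos hM fun p q p' q' h h' => ?_
  have e1 := h.sum_row
  have e2 := h.sum_col
  have e3 := h.mul_eq d
  have e1' := h'.sum_row
  have e2' := h'.sum_col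
  have e3' := h'.mul_eq d
  rw [hsum] at e1 e2 e1' e2'
  suffices h : p c = p' c ∧ q c = q' c ∧ p d = p' d ∧ q d = q' d by
    constructor
    · funext x
      rcases hd x with rfl | rfl
      exacts [h.1, h.2.2.1]
    · funext x
      rcases hd x with rfl | rfl
      exacts [h.2.1, h.2.2.2]
  rcases v with i | j
  · rw [(h.eq_zero_or_eq_zero hv).1 rfl, zero_add] at e2
    rw [(h'.eq_zero_or_eq_zero hv).1 rfl, zero_add] at e2'
    rw [e2, mul_one] at e3
    rw [e2', mul_one] at e3'
    refine ⟨by linarith, ?_, by linarith, by linarith⟩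
    rw [(h.eq_zero_or_eq_zero hv).1 rfl, (h'.eq_zero_or_eq_zero hv).1 rfl]
  · rw [(h.eq_zero_or_eq_zero hv).2 rfl, zero_add] at e1
    rw [(h'.eq_zero_or_eq_zero hv).2 rfl, zero_add] at e1'
    rw [e1, one_mul] at e3
    rw [e1', one_mul] at e3'
    refine ⟨?_, by linarith, by linarith, by linarith⟩
    rw [(h.eq_zero_or_eq_zero hv).2 rfl, (h'.eq_zero_or_eq_zero hv).2 rfl]

/-! ### Two blocks and the quadratic equation -/

theorem nonneg_of_add_nonneg_of_mul_nonneg {x y : ℝ} (h : 0 ≤ x + y) (hxy : 0 ≤ x * y) : 0 ≤ x := by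
  by_contra! hx
  nlinarith

/-- With `x = √a`, `y = √b`, `z = √r`, the difference `(r + a - b)² - 4ra` factors as in Heron's
formula into `(z - x - y)(z - x + y)(z + x - y)(z + x + y)`, all factors being positive. -/
theorem lt_mul_of_sqrt_add_sqrt_lt {a b r : ℝ} (ha : 0 ≤ a) (hb : 0 ≤ b) (hr : 0 ≤ r)
    (h : √a + √b < √r) : 4 * r * a < (r + a - b) ^ 2 ∧ a + b ≤ r := by
  have h1 := Real.sq_sqrt ha
  have h2 := Real.sq_sqrt hb
  have h3 := Real.sq_sqrt hr
  have ha0 := Real.sqrt_nonneg a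
  have hb0 := Real.sqrt_nonneg b
  generalize √a = x at *
  generalize √b = y at *
  generalize √r = z at *
  subst h1 h2 h3
  have : 0 < (z - x - y) * (z - x + y) * ((z + x - y) * (z + x + y)) :=
    mul_pos (mul_pos (by linarith) (by linarith)) (mul_pos (by linarith) (by linarith))
  refine ⟨by nlinarith, ?_⟩
  nlinarith [mul_nonneg ha0 hb0]

/-- The distribution of the masses `σ` and `τ` on the rows and columns of two blocks with block sums
`a` and `b`. -/
theorem exists_two_block_mass {a b σ τ ε : ℝ} (ha : 0 ≤ a) (hb : 0 ≤ b) (hσ : 0 < σ) (hτ : 0 < τ)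
    (h : √a + √b < √(σ * τ)) (hε : ε ^ 2 = 1) :
    ∃ p q : ℝ, 0 ≤ p ∧ 0 ≤ q ∧ p ≤ σ ∧ q ≤ τ ∧ p * q = a ∧ (σ - p) * (τ - q) = b ∧
      τ * p - σ * q = ε * √((σ * τ + a - b) ^ 2 - 4 * (σ * τ) * a) := by
  obtain ⟨hD, hab⟩ := lt_mul_of_sqrt_add_sqrt_lt ha hb (mul_pos hσ hτ).le h
  have hd := Real.sq_sqrt (sub_nonneg.2 hD.le)
  generalize √((σ * τ + a - b) ^ 2 - 4 * (σ * τ) * a) = d at *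
  have hr := mul_pos hσ hτ
  -- Here `x = τ p` and `y = σ q`. The two product conditions prescribe `x + y` and `x y`, so these
  -- are the roots of a quadratic, and `ε` selects their order.
  set x := (σ * τ + a - b + ε * d) / 2 with hx
  set y := (σ * τ + a - b - ε * d) / 2 with hy
  have hxy : x * y = σ * τ * a := by
    rw [hx, hy]
    linear_combination (-d ^ 2 / 4) * hε - hd / 4
  have hsum : x + y = σ * τ + a - b := by
    rw [hx, hy]
    ring
  have hdiff : x - y = ε * d := by
    rw [hx, hy]
    ring
  clear_value x y
  have hmul : (σ * τ - x) * (σ * τ - y) = σ * τ * b := by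
    linear_combination hxy - σ * τ * hsum
  have hx0 : 0 ≤ x :=
    nonneg_of_add_nonneg_of_mul_nonneg (y := y) (by linarith) (by rw [hxy]; positivity)
  have hy0 : 0 ≤ y :=
    nonneg_of_add_nonneg_of_mul_nonneg (y := x) (by linarith) (by rw [mul_comm, hxy]; positivity)
  have hx1 : 0 ≤ σ * τ - x :=
    nonneg_of_add_nonneg_of_mul_nonneg (y := σ * τ - y) (by linarith) (by rw [hmul]; positivity)
  have hy1 : 0 ≤ σ * τ - y :=
    nonneg_of_add_nonneg_of_mul_nonneg (y := σ * τ - x) (by linarith)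
      (by rw [mul_comm, hmul]; positivity)
  refine ⟨x / τ, y / σ, div_nonneg hx0 hτ.le, div_nonneg hy0 hσ.le, ?_, ?_, ?_, ?_, ?_⟩
  · rw [div_le_iff₀ hτ]
    linarith
  · rw [div_le_iff₀ hσ]
    linarith
  · field_simp
    linear_combination hxy
  · field_simp
    linear_combination hmul
  · field_simp
    exact hdiff

theorem HasEdge.exists_row_col {c : Block S} (hc : HasEdge c) :
    (∃ i, rowBlock S i = c) ∧ ∃ j, colBlock S j = c := by
  obtain ⟨v, hv, w, hw, h⟩ := hc
  rcases v with i | j <;> rcases w with k | l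
  · exact h.elim
  · exact ⟨⟨i, hv⟩, l, hw⟩
  · exact ⟨⟨k, hw⟩, j, hv⟩
  · exact h.elim

/-- Both masses of `c` are determined by `p c - q c`, since `p c + q c = 1 + b c - b d`. The square
of this difference is the positive discriminant, and both signs occur. -/
theorem encard_completions_eq_two (hpos : ∀ e : S, 0 < M e) (hM : Completable M)
    (hb : ∑ c, √(blockSum M c) < 1) (hcard : Fintype.card (Block S) = 2)
    (hedge : ∀ c : Block S, HasEdge c) : (completions M).encard = 2 := by
  classical
  have hbij := bijOn_completions hpos hM
  rw [← hbij.injOn.encard_image, hbij.image_eq]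
  have hnn : ∀ c, 0 ≤ blockSum M c := by
    obtain ⟨A, hA⟩ := hM
    have h := isBlockMass_of_mem_completions hpos hA
    intro c
    rw [← h.mul_eq]
    exact mul_nonneg (h.row_nonneg c) (h.col_nonneg c)
  obtain ⟨c⟩ : Nonempty (Block S) := Fintype.card_pos_iff.1 (by omega)
  obtain ⟨d, hdc, hd, hsum⟩ := exists_sum_eq_of_card_eq_two hcard c
  rw [hsum] at hb
  have hlt : √(blockSum M c) + √(blockSum M d) < √((1 : ℝ) * 1) := by simpa using hb
  obtain ⟨hD, -⟩ := lt_mul_of_sqrt_add_sqrt_lt (hnn c) (hnn d) (by norm_num) hlt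
  have hD' := Real.sqrt_pos.2 (sub_pos.2 hD)
  have hex : ∀ ε : ℝ, ε ^ 2 = 1 → ∃ p q, IsBlockMass M p q ∧ p c - q c =
      ε * √(((1 : ℝ) * 1 + blockSum M c - blockSum M d) ^ 2 - 4 * (1 * 1) * blockSum M c) := by
    intro ε hε
    obtain ⟨x, y, hx0, hy0, hx1, hy1, hxy, hxy', hdiff⟩ :=
      exists_two_block_mass (hnn c) (hnn d) one_pos one_pos hlt hε
    refine ⟨fun e => if e = c then x else 1 - x, fun e => if e = c then y else 1 - y,
      ⟨fun e => ?_, fun e => ?_, ?_, ?_, fun e => ?_, fun e he => ?_, fun e he => ?_⟩, ?_⟩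
    · split_ifs
      exacts [hx0, sub_nonneg.2 hx1]
    · split_ifs
      exacts [hy0, sub_nonneg.2 hy1]
    · rw [hsum]
      simp [hdc]
    · rw [hsum]
      simp [hdc]
    · rcases hd e with rfl | rfl
      · simpa using hxy
      · simpa [hdc] using hxy'
    · obtain ⟨i, hi⟩ := (hedge e).exists_row_col.1
      exact absurd hi (he i)
    · obtain ⟨j, hj⟩ := (hedge e).exists_row_col.2
      exact absurd hj (he j)
    · simpa using hdiff
  obtain ⟨p₁, q₁, h₁, hd₁⟩ := hex 1 (by norm_num)
  obtain ⟨p₂, q₂, h₂, hd₂⟩ := hex (-1) (by norm_num)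
  have hdet : ∀ p q p' q', IsBlockMass M p q → IsBlockMass M p' q' →
      p c - q c = p' c - q' c → (p, q) = (p', q') := by
    intro p q p' q' h h' hpq
    have e1 := h.sum_row
    have e2 := h.sum_col
    have e1' := h'.sum_row
    have e2' := h'.sum_col
    have e3 := h.mul_eq d
    have e3' := h'.mul_eq d
    have e4 := h.mul_eq c
    have e4' := h'.mul_eq c
    rw [hsum] at e1 e2 e1' e2'
    have hd1 : p d = 1 - p c := by linarith
    have hd2 : q d = 1 - q c := by linarith
    have hd1' : p' d = 1 - p' c := by linarith
    have hd2' : q' d = 1 - q' c := by linarith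
    rw [hd1, hd2] at e3
    rw [hd1', hd2'] at e3'
    -- Subtracting the product equations of the two blocks cancels the quadratic terms.
    have hs : p c + q c = p' c + q' c := by linear_combination e4 - e4' - e3 + e3'
    have hp : p c = p' c := by linarith
    have hq : q c = q' c := by linarith
    refine Prod.ext (funext fun x => ?_) (funext fun x => ?_)
    · rcases hd x with rfl | rfl
      · exact hp
      · simp only [hd1, hd1', hp]
    · rcases hd x with rfl | rfl
      · exact hq
      · simp only [hd2, hd2', hq]
  have hset : {x : (Block S → ℝ) × (Block S → ℝ) | IsBlockMass M x.1 x.2} =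
      {(p₁, q₁), (p₂, q₂)} := by
    ext ⟨p, q⟩
    simp only [Set.mem_ofPred_eq, Set.mem_insert_iff, Set.mem_singleton_iff]
    constructor
    · intro h
      have e3 := h.mul_eq d
      have e4 := h.mul_eq c
      have e1 := h.sum_row
      have e2 := h.sum_col
      rw [hsum] at e1 e2
      have hsq : (p c - q c) ^ 2 =
          √(((1 : ℝ) * 1 + blockSum M c - blockSum M d) ^ 2 - 4 * (1 * 1) * blockSum M c) ^ 2 := by
        rw [Real.sq_sqrt (sub_nonneg.2 hD.le), ← e3, ← e4, show p d = 1 - p c by linarith,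
          show q d = 1 - q c by linarith]
        ring
      rcases sq_eq_sq_iff_eq_or_eq_neg.1 hsq with h' | h'
      · left
        exact hdet _ _ _ _ h h₁ (by linarith)
      · right
        exact hdet _ _ _ _ h h₂ (by linarith)
    · rintro (h | h) <;> obtain ⟨rfl, rfl⟩ := Prod.ext_iff.1 h
      exacts [h₁, h₂]
  rw [hset]
  refine Set.encard_pair fun h => ?_
  obtain ⟨rfl, rfl⟩ := Prod.ext_iff.1 h
  linarith

/-! ### Semialgebraic description and the ring of functions -/

open MvPolynomial

theorem isBasicSemialgebraic_completions (M : S → ℝ) :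
    IsBasicSemialgebraic (Function.uncurry '' completions M) := by
  classical
  let F₁ : Finset (MvPolynomial (Fin m × Fin n) ℝ) :=
    Finset.univ.image fun t : (Fin m × Fin m) × (Fin n × Fin n) =>
      X (t.1.1, t.2.1) * X (t.1.2, t.2.2) - X (t.1.1, t.2.2) * X (t.1.2, t.2.1)
  let F₂ : Finset (MvPolynomial (Fin m × Fin n) ℝ) :=
    Finset.univ.image fun e : S => X e.1 - C (M e)
  refine ⟨F₁ ∪ F₂ ∪ {∑ k, ∑ l, X (k, l) - 1}, Finset.univ.image X, ?_⟩
  ext x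
  have hx : x ∈ Function.uncurry '' completions M ↔ Matrix.of (Function.curry x) ∈ completions M := by
    constructor
    · rintro ⟨A, hA, rfl⟩
      exact hA
    · intro h
      exact ⟨_, h, funext fun _ => rfl⟩
  rw [hx, mem_completions_iff]
  simp only [Matrix.of_apply, Function.curry, Set.mem_ofPred_eq, Finset.mem_union,
    Finset.mem_singleton, F₁, F₂, Finset.mem_image, Finset.mem_univ, true_and]
  constructor
  · rintro ⟨h1, h2, h3, h4⟩
    constructor
    · rintro f ((⟨t, rfl⟩ | ⟨e, rfl⟩) | rfl)
      · simpa [sub_eq_zero] using h1 t.1.1 t.1.2 t.2.1 t.2.2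
      · simpa [sub_eq_zero] using h4 e
      · simpa [sub_eq_zero] using h3
    · rintro g ⟨e, rfl⟩
      simpa using h2 e.1 e.2
  · rintro ⟨h1, h2⟩
    refine ⟨fun i k j l => ?_, fun i j => ?_, ?_, fun e => ?_⟩
    · simpa [sub_eq_zero] using h1 _ (.inl (.inl ⟨((i, k), (j, l)), rfl⟩))
    · simpa using h2 _ ⟨(i, j), rfl⟩
    · simpa [sub_eq_zero] using h1 _ (.inr rfl)
    · simpa [sub_eq_zero] using h1 _ (.inl (.inr ⟨e, rfl⟩))

/-- The block `c` contains a row. -/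
def HasRow (c : Block S) : Prop := ∃ i, rowBlock S i = c

/-- The block `c` contains a column. -/
def HasCol (c : Block S) : Prop := ∃ j, colBlock S j = c

theorem hasRow_or_hasCol (c : Block S) : HasRow c ∨ HasCol c := by
  induction c using SimpleGraph.ConnectedComponent.ind with
  | h v =>
    rcases v with i | j
    exacts [.inl ⟨i, rfl⟩, .inr ⟨j, rfl⟩]

theorem blockSum_nonneg (hpos : ∀ e : S, 0 < M e) (hM : Completable M) (c : Block S) :
    0 ≤ blockSum M c := by
  obtain ⟨A, hA⟩ := hM
  have h := isBlockMass_of_mem_completions hpos hA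
  rw [← h.mul_eq]
  exact mul_nonneg (h.row_nonneg c) (h.col_nonneg c)

/-- A row and a column in one block both meet edges, so the block has positive row mass and positive
column mass. -/
theorem blockSum_pos (hpos : ∀ e : S, 0 < M e) (hM : Completable M) {c : Block S}
    (hr : HasRow c) (hc : HasCol c) : 0 < blockSum M c := by
  obtain ⟨A, hA⟩ := hM
  obtain ⟨i, hi⟩ := hr
  obtain ⟨j, hj⟩ := hc
  have hij : (graph S).Reachable (.inl i) (.inr j) :=
    SimpleGraph.ConnectedComponent.eq.1 (hi.trans hj.symm)
  obtain ⟨l, hl⟩ := exists_mem_of_row_reachable hij (by simp)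
  obtain ⟨k, hk⟩ := exists_mem_of_col_reachable hij.symm (by simp)
  rw [blockSum_eq hpos hA]
  refine mul_pos ?_ ?_
  · have := rowSum_le_rowMass hA i
    rw [hi] at this
    exact (rowSum_pos_of_mem hpos hA hl).trans_le this
  · have := colSum_le_colMass hA j
    rw [hj] at this
    exact (colSum_pos_of_mem hpos hA hk).trans_le this

theorem blockSum_eq_zero_of_not_hasRow (hpos : ∀ e : S, 0 < M e) (hM : Completable M) {c : Block S}
    (hr : ¬ HasRow c) : blockSum M c = 0 := by
  obtain ⟨A, hA⟩ := hM
  have h := isBlockMass_of_mem_completions hpos hA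
  rw [← h.mul_eq, h.row_eq_zero c fun i hi => hr ⟨i, hi⟩, zero_mul]

theorem blockSum_eq_zero_of_not_hasCol (hpos : ∀ e : S, 0 < M e) (hM : Completable M) {c : Block S}
    (hr : ¬ HasCol c) : blockSum M c = 0 := by
  obtain ⟨A, hA⟩ := hM
  have h := isBlockMass_of_mem_completions hpos hA
  rw [← h.mul_eq, h.col_eq_zero c fun i hi => hr ⟨i, hi⟩, mul_zero]

theorem exists_hasRow (hpos : ∀ e : S, 0 < M e) (hM : Completable M) : ∃ c : Block S, HasRow c := by
  obtain ⟨A, hA⟩ := hM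
  have h := isBlockMass_of_mem_completions hpos hA
  by_contra! hc
  have := h.sum_row
  rw [Finset.sum_eq_zero fun c _ => h.row_eq_zero c fun i hi => hc c ⟨i, hi⟩] at this
  exact zero_ne_one this

theorem exists_hasCol (hpos : ∀ e : S, 0 < M e) (hM : Completable M) : ∃ c : Block S, HasCol c := by
  obtain ⟨A, hA⟩ := hM
  have h := isBlockMass_of_mem_completions hpos hA
  by_contra! hc
  have := h.sum_col
  rw [Finset.sum_eq_zero fun c _ => h.col_eq_zero c fun i hi => hc c ⟨i, hi⟩] at this
  exact zero_ne_one this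

/-- The mass of the rows of a block as a linear form in the entries of a matrix. -/
def rowMassPoly (c : Block S) : MvPolynomial (Fin m × Fin n) ℝ :=
  open scoped Classical in ∑ i with rowBlock S i = c, ∑ j, X (i, j)

/-- The mass of the columns of a block as a linear form in the entries of a matrix. -/
def colMassPoly (c : Block S) : MvPolynomial (Fin m × Fin n) ℝ :=
  open scoped Classical in ∑ j with colBlock S j = c, ∑ i, X (i, j)

theorem eval_rowMassPoly (A : Matrix (Fin m) (Fin n) ℝ) (c : Block S) :
    eval (Function.uncurry A) (rowMassPoly c) = rowMass A c := by
  simp [rowMassPoly, rowMass, rowSum, Function.uncurry]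

theorem eval_colMassPoly (A : Matrix (Fin m) (Fin n) ℝ) (c : Block S) :
    eval (Function.uncurry A) (colMassPoly c) = colMass A c := by
  simp [colMassPoly, colMass, colSum, Function.uncurry]

/-- The coordinate of a block mass at the block `c`: the row mass if there are rows, and the column
mass otherwise. -/
def massCoord (p q : Block S → ℝ) (c : Block S) : ℝ :=
  open scoped Classical in if HasRow c then p c else q c

/-- The coordinate at the block `c` as a linear form in the entries of a matrix. -/
def massCoordPoly (c : Block S) : MvPolynomial (Fin m × Fin n) ℝ :=
  open scoped Classical in if HasRow c then rowMassPoly c else colMassPoly c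

theorem eval_massCoordPoly (A : Matrix (Fin m) (Fin n) ℝ) (c : Block S) :
    eval (Function.uncurry A) (massCoordPoly c) = massCoord (rowMass A) (colMass A) c := by
  rw [massCoordPoly, massCoord]
  split_ifs
  exacts [eval_rowMassPoly A c, eval_colMassPoly A c]

/-- The ring of polynomial functions on the set of completions. -/
abbrev CompletionRing (M : S → ℝ) : Type :=
  MvPolynomial (Fin m × Fin n) ℝ ⧸ vanishingIdeal ℝ (Function.uncurry '' completions M)

theorem completionRing_mk_eq_iff {f g : MvPolynomial (Fin m × Fin n) ℝ} :
    (Ideal.Quotient.mk _ f : CompletionRing M) = Ideal.Quotient.mk _ g ↔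
      ∀ A ∈ completions M, eval (Function.uncurry A) f = eval (Function.uncurry A) g := by
  rw [Ideal.Quotient.eq, mem_vanishingIdeal_iff]
  simp only [aeval_eq_eval, map_sub, sub_eq_zero]
  exact Set.forall_mem_image

/-- The polynomial functions on the completions given by polynomials in the coordinates of the block
masses. -/
def massHom (M : S → ℝ) : MvPolynomial (Block S) ℝ →ₐ[ℝ] CompletionRing M :=
  (Ideal.Quotient.mkₐ ℝ _).comp (aeval massCoordPoly)

/-- This reduces identities in the ring of functions to pointwise checks on completions. -/
theorem massHom_eq_iff {f : MvPolynomial (Block S) ℝ} {g : MvPolynomial (Fin m × Fin n) ℝ} :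
    massHom M f = Ideal.Quotient.mk _ g ↔ ∀ A ∈ completions M,
      eval (massCoord (rowMass A) (colMass A)) f = eval (Function.uncurry A) g := by
  refine (completionRing_mk_eq_iff (f := aeval massCoordPoly f)).trans ?_
  refine forall₂_congr fun A hA => ?_
  have : eval (Function.uncurry A) (aeval massCoordPoly f) =
      eval (massCoord (S := S) (rowMass A) (colMass A)) f := by
    have h := MvPolynomial.map_aeval (massCoordPoly (S := S)) (eval (Function.uncurry A)) f
    rw [h]
    simp only [eval_massCoordPoly]
    have hC : (eval (Function.uncurry A)).comp (algebraMap ℝ (MvPolynomial (Fin m × Fin n) ℝ)) =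
        RingHom.id ℝ := by
      ext r
      simp
    rw [hC]
    rfl
  rw [this]

open scoped Classical in
/-- The product of the coordinates at the blocks containing edges. -/
def edgeProd (S : Set (Fin m × Fin n)) : MvPolynomial (Block S) ℝ :=
  ∏ c : Block S with HasRow c ∧ HasCol c, X c

open scoped Classical in
/-- The mass of the columns of a block, multiplied by `edgeProd`, in terms of the coordinates. -/
def scaledColMass (M : S → ℝ) (c : Block S) : MvPolynomial (Block S) ℝ :=
  if HasCol c then
    if HasRow c then
      -- On a block with an edge the column mass is `b / X c`; multiplying by `edgeProd` cancels the
      -- denominator.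
      C (blockSum M c) * ∏ d ∈ ({d | HasRow d ∧ HasCol d} : Finset (Block S)).erase c, X d
    else edgeProd S * X c
  else 0

open scoped Classical in
theorem eval_scaledColMass_of_hasRow {t : Block S → ℝ} {c : Block S} (hr : HasRow c)
    (hc : HasCol c) (ht : t c ≠ 0) :
    eval t (scaledColMass M c) = eval t (edgeProd S) * (blockSum M c / t c) := by
  have hmem : c ∈ ({d | HasRow d ∧ HasCol d} : Finset (Block S)) :=
    Finset.mem_filter.2 ⟨Finset.mem_univ _, hr, hc⟩
  rw [scaledColMass, if_pos hc, if_pos hr, edgeProd, ← Finset.mul_prod_erase _ _ hmem]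
  simp only [map_mul, eval_C, eval_X]
  field_simp

theorem IsBlockMass.eval_scaledColMass {p q : Block S → ℝ} (hpos : ∀ e : S, 0 < M e)
    (hM : Completable M) (h : IsBlockMass M p q) (c : Block S) :
    eval (massCoord p q) (scaledColMass M c) = eval (massCoord p q) (edgeProd S) * q c := by
  by_cases hc : HasCol c
  · by_cases hr : HasRow c
    · have hb := blockSum_pos hpos hM hr hc
      rw [← h.mul_eq] at hb
      have hp : p c ≠ 0 := left_ne_zero_of_mul hb.ne'
      have ht : massCoord p q c = p c := if_pos hr
      rw [eval_scaledColMass_of_hasRow hr hc (by rwa [ht]), ht, ← h.mul_eq,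
        mul_div_cancel_left₀ _ hp]
    · rw [scaledColMass, if_pos hc, if_neg hr, map_mul, eval_X, massCoord, if_neg hr]
  · rw [scaledColMass, if_neg hc, h.col_eq_zero c fun j hj => hc ⟨j, hj⟩, map_zero, mul_zero]

/-! ### Upper bound for the dimension -/

open scoped Classical in
/-- The polynomial expressing that the row masses sum to one. -/
def rowRelation (S : Set (Fin m × Fin n)) : MvPolynomial (Block S) ℝ :=
  ∑ c : Block S with HasRow c, X c - 1

/-- The polynomial expressing that the column masses sum to one. -/
def colRelation (M : S → ℝ) : MvPolynomial (Block S) ℝ :=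
  ∑ c : Block S, scaledColMass M c - edgeProd S

theorem massHom_rowRelation (hpos : ∀ e : S, 0 < M e) : massHom M (rowRelation S) = 0 := by
  classical
  rw [← map_zero (Ideal.Quotient.mk _), massHom_eq_iff]
  intro A hA
  have h := isBlockMass_of_mem_completions hpos hA
  rw [rowRelation, map_sub, map_sum, map_one, map_zero, sub_eq_zero, ← h.sum_row,
    Finset.sum_filter]
  refine Finset.sum_congr rfl fun c _ => ?_
  rw [eval_X, massCoord]
  split_ifs with hr
  · rfl
  · exact (h.row_eq_zero c fun i hi => hr ⟨i, hi⟩).symm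

theorem massHom_colRelation (hpos : ∀ e : S, 0 < M e) (hM : Completable M) :
    massHom M (colRelation M) = 0 := by
  rw [← map_zero (Ideal.Quotient.mk _), massHom_eq_iff]
  intro A hA
  have h := isBlockMass_of_mem_completions hpos hA
  rw [colRelation, map_sub, map_sum, map_zero,
    Finset.sum_congr rfl fun c _ => h.eval_scaledColMass hpos hM c, ← Finset.mul_sum, h.sum_col,
    mul_one, sub_self]

theorem prime_rowRelation (hpos : ∀ e : S, 0 < M e) (hM : Completable M) :
    Prime (rowRelation S) := by
  classical
  obtain ⟨c, hc⟩ := exists_hasRow hpos hM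
  exact prime_sum_X_sub_one ⟨c, Finset.mem_filter.2 ⟨Finset.mem_univ _, hc⟩⟩

/-- It suffices to find a zero of the row relation where the column relation is negative. Spread the
slack `1 - ∑ √b` evenly over the blocks with rows, taking `t c = √b + δ` there and `0` elsewhere.
Then `b / t c ≤ √b`, so the column total is at most `∑ √b < 1`. -/
theorem not_rowRelation_dvd_colRelation (hpos : ∀ e : S, 0 < M e) (hM : Completable M)
    (hb : ∑ c, √(blockSum M c) < 1) : ¬ rowRelation S ∣ colRelation M := by
  classical
  rintro ⟨g, hg⟩
  set B := ∑ c, √(blockSum M c) with hB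
  set T : Finset (Block S) := {c | HasRow c} with hT
  have hTc : 0 < (T.card : ℝ) := by
    obtain ⟨c, hc⟩ := exists_hasRow hpos hM
    exact_mod_cast Finset.card_pos.2 ⟨c, Finset.mem_filter.2 ⟨Finset.mem_univ _, hc⟩⟩
  set δ := (1 - B) / T.card with hδ
  have hδ0 : 0 < δ := div_pos (by linarith) hTc
  let t : Block S → ℝ := fun c => if HasRow c then √(blockSum M c) + δ else 0
  have htpos : ∀ c, HasRow c → 0 < t c := fun c hc => by
    simp only [t, if_pos hc]
    positivity
  have h1 : eval t (rowRelation S) = 0 := by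
    have e1 : ∑ c ∈ T, √(blockSum M c) = B := by
      rw [hB, hT, Finset.sum_filter]
      refine Finset.sum_congr rfl fun c _ => ?_
      split_ifs with hc
      · rfl
      · rw [blockSum_eq_zero_of_not_hasRow hpos hM hc, Real.sqrt_zero]
    have e2 : ∑ c ∈ T, t c = ∑ c ∈ T, (√(blockSum M c) + δ) :=
      Finset.sum_congr rfl fun c hc => if_pos (Finset.mem_filter.1 hc).2
    rw [rowRelation, map_sub, map_sum, map_one]
    simp only [eval_X]
    rw [e2, Finset.sum_add_distrib, e1, Finset.sum_const, nsmul_eq_mul, hδ,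
      mul_div_cancel₀ _ hTc.ne']
    ring
  have hD : 0 < eval t (edgeProd S) := by
    rw [edgeProd, map_prod]
    refine Finset.prod_pos fun c hc => ?_
    rw [eval_X]
    exact htpos c (Finset.mem_filter.1 hc).2.1
  have h2 : ∀ c, eval t (scaledColMass M c) ≤ eval t (edgeProd S) * √(blockSum M c) := by
    intro c
    by_cases hc : HasCol c
    · by_cases hr : HasRow c
      · rw [eval_scaledColMass_of_hasRow hr hc (htpos c hr).ne']
        refine mul_le_mul_of_nonneg_left ?_ hD.le
        rw [div_le_iff₀ (htpos c hr)]
        simp only [t, if_pos hr]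
        nlinarith [Real.mul_self_sqrt (blockSum_nonneg hpos hM c),
          mul_nonneg (Real.sqrt_nonneg (blockSum M c)) hδ0.le]
      · rw [scaledColMass, if_pos hc, if_neg hr, map_mul, eval_X]
        simp only [t, if_neg hr, mul_zero]
        positivity
    · rw [scaledColMass, if_neg hc, map_zero]
      positivity
  have h3 : eval t (colRelation M) < 0 := by
    rw [colRelation, map_sub, map_sum]
    have := Finset.sum_le_sum fun c (_ : c ∈ Finset.univ) => h2 c
    rw [← Finset.mul_sum, ← hB] at this
    nlinarith
  rw [hg, map_mul, h1, zero_mul] at h3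
  exact lt_irrefl _ h3

/-- On a block with an edge, `p c * q c` is the positive constant `b c`, so `q c / b c` inverts the
coordinate `p c`. -/
theorem isUnit_massHom_edgeProd (hpos : ∀ e : S, 0 < M e) (hM : Completable M) :
    IsUnit (massHom M (edgeProd S)) := by
  classical
  have hrow : massHom M (edgeProd S) =
      Ideal.Quotient.mk _ (∏ c : Block S with HasRow c ∧ HasCol c, rowMassPoly c) := by
    rw [massHom_eq_iff]
    intro A hA
    rw [edgeProd, map_prod, map_prod]
    refine Finset.prod_congr rfl fun c hc => ?_
    rw [eval_X, eval_rowMassPoly, massCoord, if_pos (Finset.mem_filter.1 hc).2.1]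
  refine IsUnit.of_mul_eq_one (Ideal.Quotient.mk _
    (∏ c : Block S with HasRow c ∧ HasCol c, (C (blockSum M c)⁻¹ * colMassPoly c))) ?_
  rw [hrow, ← map_mul, ← map_one (Ideal.Quotient.mk _), completionRing_mk_eq_iff]
  intro A hA
  rw [map_mul, map_prod, map_prod, map_one, ← Finset.prod_mul_distrib]
  refine Finset.prod_eq_one fun c hc => ?_
  have hc' := (Finset.mem_filter.1 hc).2
  have hb := (blockSum_pos hpos hM hc'.1 hc'.2).ne'
  rw [map_mul, eval_rowMassPoly, eval_colMassPoly, eval_C]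
  field_simp
  exact (blockSum_eq hpos hA c).symm

/-- A matrix entry is a constant times a row mass times a column mass, so one factor `edgeProd`
turns each variable into a polynomial in the coordinates. -/
theorem exists_massHom_eq_edgeProd_pow_mul (hpos : ∀ e : S, 0 < M e) (hM : Completable M)
    (r : CompletionRing M) : ∃ a N, massHom M a = massHom M (edgeProd S ^ N) * r := by
  obtain ⟨f, rfl⟩ := Ideal.Quotient.mk_surjective r
  induction f using MvPolynomial.induction_on with
  | C s =>
    refine ⟨C s, 0, ?_⟩
    rw [pow_zero, map_one, one_mul, massHom_eq_iff]
    simp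
  | add f g hf hg =>
    obtain ⟨a, N, ha⟩ := hf
    obtain ⟨b, N', hb⟩ := hg
    refine ⟨a * edgeProd S ^ N' + b * edgeProd S ^ N, N + N', ?_⟩
    rw [map_add, map_mul, map_mul, ha, hb, pow_add, map_mul, map_add]
    ring
  | mul_X f e hf =>
    obtain ⟨a, N, ha⟩ := hf
    obtain ⟨A₀, hA₀⟩ := hM
    have hX : massHom M (C (rowShare S A₀ e.1 * colShare S A₀ e.2) *
        (X (rowBlock S e.1) * scaledColMass M (colBlock S e.2))) =
        massHom M (edgeProd S) * Ideal.Quotient.mk _ (X e) := by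
      have h0 : massHom M (edgeProd S) =
          Ideal.Quotient.mk _ (aeval massCoordPoly (edgeProd S)) := rfl
      have h1 := massHom_eq_iff.1 h0
      rw [h0, ← map_mul, massHom_eq_iff]
      intro A hA
      have h := isBlockMass_of_mem_completions hpos hA
      simp only [map_mul]
      rw [← h1 A hA, h.eval_scaledColMass hpos ⟨A₀, hA₀⟩, eval_C, eval_C, eval_X,
        eval_X, massCoord, if_pos ⟨e.1, rfl⟩]
      have h2 : Function.uncurry A e = A e.1 e.2 := rfl
      rw [h2, apply_eq_of_mem_completions hA, rowSum_eq_rowShare_mul hpos hA₀ hA,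
        colSum_eq_colShare_mul hpos hA₀ hA]
      ring
    refine ⟨a * (C (rowShare S A₀ e.1 * colShare S A₀ e.2) *
        (X (rowBlock S e.1) * scaledColMass M (colBlock S e.2))), N + 1, ?_⟩
    rw [map_mul, ha, hX, pow_succ, map_mul, map_mul]
    ring

theorem ringKrullDim_completionRing_add_two_le (hpos : ∀ e : S, 0 < M e) (hM : Completable M)
    (hb : ∑ c, √(blockSum M c) < 1) :
    ringKrullDim (CompletionRing M) + 1 + 1 ≤ (Fintype.card (Block S) : WithBot ℕ∞) := by
  have h := ringKrullDim_add_two_le_of_fractions (massHom M).toRingHom (fun r => ?_)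
    (prime_rowRelation hpos hM) (not_rowRelation_dvd_colRelation hpos hM hb)
    (massHom_rowRelation hpos) (massHom_colRelation hpos hM)
  · rwa [MvPolynomial.ringKrullDim_of_isNoetherianRing, ringKrullDim_eq_zero_of_field, zero_add,
      Nat.card_eq_fintype_card] at h
  · obtain ⟨a, N, ha⟩ := exists_massHom_eq_edgeProd_pow_mul hpos hM r
    refine ⟨a, edgeProd S ^ N, ?_, ha⟩
    change IsUnit (massHom M (edgeProd S ^ N))
    rw [map_pow]
    exact (isUnit_massHom_edgeProd hpos hM).pow N

/-! ### Lower bound for the dimension -/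

/-- Two distinct blocks between which a given pair of a row mass and a column mass can be
distributed. -/
structure IsAdaptablePair (a b : Block S) : Prop where
  ne : a ≠ b
  hasRow : HasRow a
  hasCol : HasCol a ∨ HasCol b ∧ ¬ HasRow b

/-- A block with an edge pairs with any other block. If there is none, all blocks are isolated
vertices, and an isolated row pairs with an isolated column. -/
theorem exists_isAdaptablePair (hpos : ∀ e : S, 0 < M e) (hM : Completable M)
    (hcard : 1 < Fintype.card (Block S)) : ∃ a b : Block S, IsAdaptablePair a b := by
  by_cases h : ∃ a : Block S, HasRow a ∧ HasCol a
  · obtain ⟨a, har, hac⟩ := h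
    obtain ⟨b, hb⟩ := Fintype.exists_ne_of_one_lt_card hcard a
    exact ⟨a, b, hb.symm, har, .inl hac⟩
  · push Not at h
    obtain ⟨a, ha⟩ := exists_hasRow hpos hM
    obtain ⟨b, hb⟩ := exists_hasCol hpos hM
    refine ⟨a, b, ?_, ha, .inr ⟨hb, fun hr => h b hr hb⟩⟩
    rintro rfl
    exact h a ha hb

/-- If both blocks have rows and columns, this is the quadratic problem. Otherwise a missing side
sends all of `σ` or `τ` to the other block, and `b a + b b ≤ σ τ` keeps the remainder nonnegative.
-/
theorem IsAdaptablePair.exists_mass (hpos : ∀ e : S, 0 < M e) (hM : Completable M) {a b : Block S}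
    (h : IsAdaptablePair a b) {σ τ : ℝ} (hσ : 0 < σ) (hτ : 0 < τ)
    (hlt : √(blockSum M a) + √(blockSum M b) < √(σ * τ)) :
    ∃ p q p' q' : ℝ, (0 ≤ p ∧ 0 ≤ q ∧ p * q = blockSum M a ∧ (¬ HasRow a → p = 0) ∧
      (¬ HasCol a → q = 0)) ∧ (0 ≤ p' ∧ 0 ≤ q' ∧ p' * q' = blockSum M b ∧
      (¬ HasRow b → p' = 0) ∧ (¬ HasCol b → q' = 0)) ∧ p + p' = σ ∧ q + q' = τ := by
  have ha := blockSum_nonneg hpos hM a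
  have hb := blockSum_nonneg hpos hM b
  have hab := (lt_mul_of_sqrt_add_sqrt_lt ha hb (mul_pos hσ hτ).le hlt).2
  by_cases hac : HasCol a
  · by_cases hbr : HasRow b
    · by_cases hbc : HasCol b
      · obtain ⟨p, q, hp, hq, hpσ, hqτ, hpq, hpq', -⟩ :=
          exists_two_block_mass ha hb hσ hτ hlt (one_pow 2)
        exact ⟨p, q, σ - p, τ - q, ⟨hp, hq, hpq, absurd h.hasRow, absurd hac⟩,
          ⟨sub_nonneg.2 hpσ, sub_nonneg.2 hqτ, hpq', absurd hbr, absurd hbc⟩, by ring, by ring⟩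
      · have hb0 := blockSum_eq_zero_of_not_hasCol hpos hM hbc
        refine ⟨blockSum M a / τ, τ, σ - blockSum M a / τ, 0, ⟨by positivity, hτ.le,
          div_mul_cancel₀ _ hτ.ne', absurd h.hasRow, absurd hac⟩,
          ⟨?_, le_rfl, by rw [hb0, mul_zero], absurd hbr, fun _ => rfl⟩, by ring, by ring⟩
        rw [sub_nonneg, div_le_iff₀ hτ]
        linarith
    · have hb0 := blockSum_eq_zero_of_not_hasRow hpos hM hbr
      have hbc := (hasRow_or_hasCol b).resolve_left hbr
      refine ⟨σ, blockSum M a / σ, 0, τ - blockSum M a / σ, ⟨hσ.le, by positivity,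
        mul_div_cancel₀ _ hσ.ne', absurd h.hasRow, absurd hac⟩,
        ⟨le_rfl, ?_, by rw [hb0, zero_mul], fun _ => rfl, absurd hbc⟩, by ring, by ring⟩
      rw [sub_nonneg, div_le_iff₀ hσ]
      linarith
  · obtain ⟨hbc, hbr⟩ := h.hasCol.resolve_left hac
    have hb0 := blockSum_eq_zero_of_not_hasRow hpos hM hbr
    have ha0 := blockSum_eq_zero_of_not_hasCol hpos hM hac
    exact ⟨σ, 0, 0, τ, ⟨hσ.le, le_rfl, by rw [ha0, mul_zero], absurd h.hasRow, fun _ => rfl⟩,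
      ⟨le_rfl, hτ.le, by rw [hb0, zero_mul], fun _ => rfl, absurd hbc⟩, by ring, by ring⟩

/-- The coordinates outside an adaptable pair of blocks can be prescribed in a box. -/
theorem IsAdaptablePair.exists_isBlockMass (hpos : ∀ e : S, 0 < M e) (hM : Completable M)
    {a b : Block S} (h : IsAdaptablePair a b) {δ : ℝ} (hδ : 0 < δ)
    (hb : ∑ c, √(blockSum M c) + Fintype.card (Block S) * δ ≤ 1) {x : Block S → ℝ}
    (hx : ∀ c, c ≠ a → c ≠ b → x c ∈ Set.Ioo (√(blockSum M c)) (√(blockSum M c) + δ)) :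
    ∃ p q, IsBlockMass M p q ∧ ∀ c, c ≠ a → c ≠ b → massCoord p q c = x c := by
  classical
  set O : Finset (Block S) := {a, b}ᶜ with hO
  have hmemO : ∀ c, c ∈ O ↔ c ≠ a ∧ c ≠ b := fun c => by simp [hO]
  have hsum : ∀ f : Block S → ℝ, ∑ c, f c = ∑ c ∈ O, f c + (f a + f b) := fun f => by
    rw [← Finset.sum_pair h.ne, Finset.sum_compl_add_sum]
  -- Outside the pair, the coordinate `x c` forces both masses.
  let p₀ : Block S → ℝ := fun c => if HasRow c then x c else 0
  let q₀ : Block S → ℝ := fun c =>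
    if HasCol c then if HasRow c then blockSum M c / x c else x c else 0
  have hx0 : ∀ c ∈ O, 0 < x c := fun c hc =>
    (Real.sqrt_nonneg _).trans_lt (hx c ((hmemO c).1 hc).1 ((hmemO c).1 hc).2).1
  have hp₀ : ∀ c ∈ O, p₀ c ≤ √(blockSum M c) + δ := by
    intro c hc
    simp only [p₀]
    split_ifs
    · exact (hx c ((hmemO c).1 hc).1 ((hmemO c).1 hc).2).2.le
    · positivity
  have hq₀ : ∀ c ∈ O, q₀ c ≤ √(blockSum M c) + δ := by
    intro c hc
    have h1 := hx c ((hmemO c).1 hc).1 ((hmemO c).1 hc).2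
    simp only [q₀]
    split_ifs
    -- The lower end of the box is used here: `x c > √b` gives `b / x c ≤ √b`.
    · rw [div_le_iff₀ (hx0 c hc)]
      nlinarith [Real.mul_self_sqrt (blockSum_nonneg hpos hM c), Real.sqrt_nonneg (blockSum M c),
        h1.1, mul_pos hδ (hx0 c hc)]
    · exact h1.2.le
    · positivity
  have hcardO : (O.card : ℝ) * δ + 2 * δ = Fintype.card (Block S) * δ := by
    have := hsum fun _ => δ
    simp only [Finset.sum_const, nsmul_eq_mul, Finset.card_univ] at this
    linarith
  -- The other blocks use at most `√b + δ` each, so the pair keeps a margin of `2δ`.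
  have hbound : ∀ f : Block S → ℝ, (∀ c ∈ O, f c ≤ √(blockSum M c) + δ) →
      √(blockSum M a) + √(blockSum M b) < 1 - ∑ c ∈ O, f c := by
    intro f hf
    have h1 := Finset.sum_le_sum hf
    rw [Finset.sum_add_distrib, Finset.sum_const, nsmul_eq_mul] at h1
    rw [hsum] at hb
    linarith
  have hσ := hbound p₀ hp₀
  have hτ := hbound q₀ hq₀
  have hs0 : 0 ≤ √(blockSum M a) + √(blockSum M b) := by positivity
  obtain ⟨pa, qa, pb, qb, ⟨hpa, hqa, hpqa, hra, hca⟩, ⟨hpb, hqb, hpqb, hrb, hcb⟩, hp, hq⟩ :=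
    h.exists_mass hpos hM (hs0.trans_lt hσ) (hs0.trans_lt hτ) (by
      rw [Real.lt_sqrt hs0, sq]
      exact mul_lt_mul'' hσ hτ hs0 hs0)
  let P : Block S → ℝ := fun c => if c = a then pa else if c = b then pb else p₀ c
  let Q : Block S → ℝ := fun c => if c = a then qa else if c = b then qb else q₀ c
  have hPa : P a = pa := if_pos rfl
  have hQa : Q a = qa := if_pos rfl
  have hPb : P b = pb := by simp [P, h.ne.symm]
  have hQb : Q b = qb := by simp [Q, h.ne.symm]
  have hPO : ∀ c ∈ O, P c = p₀ c := fun c hc => by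
    simp [P, ((hmemO c).1 hc).1, ((hmemO c).1 hc).2]
  have hQO : ∀ c ∈ O, Q c = q₀ c := fun c hc => by
    simp [Q, ((hmemO c).1 hc).1, ((hmemO c).1 hc).2]
  have hcases : ∀ c, c = a ∨ c = b ∨ c ∈ O := fun c => by
    rw [hmemO]
    tauto
  refine ⟨P, Q, ⟨fun c => ?_, fun c => ?_, ?_, ?_, fun c => ?_, fun c hc => ?_, fun c hc => ?_⟩,
    fun c hca hcb => ?_⟩
  · rcases hcases c with rfl | rfl | hc
    · rwa [hPa]
    · rwa [hPb]
    · rw [hPO c hc]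
      simp only [p₀]
      split_ifs
      exacts [(hx0 c hc).le, le_rfl]
  · rcases hcases c with rfl | rfl | hc
    · rwa [hQa]
    · rwa [hQb]
    · rw [hQO c hc]
      simp only [q₀]
      split_ifs
      exacts [div_nonneg (blockSum_nonneg hpos hM c) (hx0 c hc).le, (hx0 c hc).le, le_rfl]
  · rw [hsum, Finset.sum_congr rfl hPO, hPa, hPb, hp]
    ring
  · rw [hsum, Finset.sum_congr rfl hQO, hQa, hQb, hq]
    ring
  · rcases hcases c with rfl | rfl | hc
    · rwa [hPa, hQa]
    · rwa [hPb, hQb]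
    · rw [hPO c hc, hQO c hc]
      simp only [p₀, q₀]
      split_ifs with h1 h2 h2
      · exact mul_div_cancel₀ _ (hx0 c hc).ne'
      · rw [mul_zero, blockSum_eq_zero_of_not_hasCol hpos hM h2]
      · rw [zero_mul, blockSum_eq_zero_of_not_hasRow hpos hM h1]
      · rw [zero_mul, blockSum_eq_zero_of_not_hasRow hpos hM h1]
  · have hc' : ¬ HasRow c := fun ⟨i, hi⟩ => hc i hi
    rcases hcases c with rfl | rfl | hcO
    · rw [hPa, hra hc']
    · rw [hPb, hrb hc']
    · rw [hPO c hcO]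
      exact if_neg hc'
  · have hc' : ¬ HasCol c := fun ⟨i, hi⟩ => hc i hi
    rcases hcases c with rfl | rfl | hcO
    · rw [hQa, hca hc']
    · rw [hQb, hcb hc']
    · rw [hQO c hcO]
      exact if_neg hc'
  · have hcO := (hmemO c).2 ⟨hca, hcb⟩
    rw [massCoord, hPO c hcO, hQO c hcO]
    by_cases hr : HasRow c
    · simp only [p₀, if_pos hr]
    · simp only [q₀, if_neg hr, if_pos ((hasRow_or_hasCol c).resolve_left hr)]

/-- The coordinates outside an adaptable pair take all values in a box with infinite sides, and a
polynomial vanishing on such a box is zero. They are therefore algebraically independent functions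
on the completions. -/
theorem card_sub_two_le_ringKrullDim_completionRing (hpos : ∀ e : S, 0 < M e)
    (hM : Completable M) (hb : ∑ c, √(blockSum M c) < 1) (hcard : 2 < Fintype.card (Block S)) :
    ((Fintype.card (Block S) - 2 : ℕ) : WithBot ℕ∞) ≤ ringKrullDim (CompletionRing M) := by
  classical
  obtain ⟨a, b, h⟩ := exists_isAdaptablePair hpos hM (by omega)
  let ι : Type := {c : Block S // c ∈ ({a, b}ᶜ : Finset (Block S))}
  have hι : Nat.card ι = Fintype.card (Block S) - 2 := by
    rw [Nat.card_eq_fintype_card, Fintype.card_coe, Finset.card_compl, Finset.card_pair h.ne]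
  have hmem : ∀ c : ι, c.1 ≠ a ∧ c.1 ≠ b := fun c => by simpa using c.2
  set s := (Fintype.card (Block S) : ℝ) with hs
  have hs0 : 0 < s := by
    rw [hs]
    exact_mod_cast (by omega : 0 < Fintype.card (Block S))
  set δ := (1 - ∑ c, √(blockSum M c)) / s with hδ
  have hδ0 : 0 < δ := div_pos (by linarith) hs0
  have hδ1 : ∑ c, √(blockSum M c) + s * δ ≤ 1 := by
    rw [hδ, mul_div_cancel₀ _ hs0.ne']
    linarith
  let f : MvPolynomial ι ℝ →ₐ[ℝ] CompletionRing M := (massHom M).comp (rename Subtype.val)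
  have hf : Function.Injective f := by
    rw [injective_iff_map_eq_zero]
    intro g hg
    have hg' : massHom M (rename Subtype.val g) = Ideal.Quotient.mk _ 0 := hg.trans (map_zero _).symm
    rw [massHom_eq_iff] at hg'
    refine funext_set (fun c : ι => Set.Ioo (√(blockSum M c.1)) (√(blockSum M c.1) + δ))
      (fun c => Set.Ioo_infinite (by linarith)) fun y hy => ?_
    let x : Block S → ℝ := fun c =>
      if hc : c ∈ ({a, b}ᶜ : Finset (Block S)) then y ⟨c, hc⟩ else 0
    have hxy : ∀ c : ι, x c.1 = y c := fun c => dif_pos c.2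
    obtain ⟨p, q, hpq, hx⟩ := h.exists_isBlockMass hpos hM hδ0 hδ1 (x := x) fun c hca hcb => by
      have hc : c ∈ ({a, b}ᶜ : Finset (Block S)) := by simp [hca, hcb]
      rw [hxy ⟨c, hc⟩]
      exact hy ⟨c, hc⟩ (Set.mem_univ _)
    obtain ⟨A, hA, hAe⟩ := (bijOn_completions hpos hM).surjOn
      (show (p, q) ∈ {x : (Block S → ℝ) × (Block S → ℝ) | IsBlockMass M x.1 x.2} from hpq)
    obtain ⟨rfl, rfl⟩ := Prod.ext_iff.1 hAe
    have h1 := hg' A hA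
    rw [map_zero, eval_rename] at h1
    rw [map_zero, ← h1]
    congr 2
    funext c
    rw [← hxy c]
    exact (hx c.1 (hmem c).1 (hmem c).2).symm
  rw [← hι]
  exact natCard_le_ringKrullDim_of_injective f hf

theorem semialgebraicDim_completions (hpos : ∀ e : S, 0 < M e) (hM : Completable M)
    (hb : ∑ c, √(blockSum M c) < 1) (hcard : 2 < Fintype.card (Block S)) :
    semialgebraicDim (Function.uncurry '' completions M) =
      ((Fintype.card (Block S) - 2 : ℕ) : WithBot ℕ∞) := by
  refine le_antisymm ?_ (card_sub_two_le_ringKrullDim_completionRing hpos hM hb hcard)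
  have h := ringKrullDim_completionRing_add_two_le hpos hM hb
  -- Writing the number of blocks as `2 + k + 1` makes the natural subtraction of `2` harmless; the
  -- bound is then cancelled separately for `⊥`, `⊤` and finite dimensions.
  obtain ⟨k, hk⟩ := Nat.exists_eq_add_of_lt hcard
  rw [hk] at h ⊢
  change ringKrullDim (CompletionRing M) ≤ _
  generalize ringKrullDim (CompletionRing M) = d at h ⊢
  induction d with
  | bot => exact bot_le
  | coe d =>
    have h' : d + 1 + 1 ≤ ((2 + k + 1 : ℕ) : ℕ∞) := WithBot.coe_le_coe.1 h
    refine WithBot.coe_le_coe.2 ?_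
    induction d with
    | top => simp at h'
    | coe d =>
      have h'' : d + 1 + 1 ≤ 2 + k + 1 := by exact_mod_cast h'
      exact_mod_cast (by omega : d ≤ 2 + k + 1 - 2)

end PartialMatrix

end

theorem theorem3p1 {m n : ℕ} (S : Set (Fin m × Fin n)) (M : S → ℝ)
    (hpos : ∀ e : S, 0 < M e) (hM : PartialMatrix.Completable M) :
    (∑ c : PartialMatrix.Block S, √(PartialMatrix.blockSum M c) = 1 →
      ∃! A : Matrix (Fin m) (Fin n) ℝ, A ∈ PartialMatrix.completions M) ∧
    (∑ c : PartialMatrix.Block S, √(PartialMatrix.blockSum M c) < 1 →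
      Fintype.card (PartialMatrix.Block S) = 2 →
      (∃ c : PartialMatrix.Block S, PartialMatrix.IsIsolatedVertex c) →
      ∃! A : Matrix (Fin m) (Fin n) ℝ, A ∈ PartialMatrix.completions M) ∧
    (∑ c : PartialMatrix.Block S, √(PartialMatrix.blockSum M c) < 1 →
      Fintype.card (PartialMatrix.Block S) = 2 →
      (∀ c : PartialMatrix.Block S, PartialMatrix.HasEdge c) →
      (PartialMatrix.completions M).encard = 2) ∧
    (∑ c : PartialMatrix.Block S, √(PartialMatrix.blockSum M c) < 1 →
      2 < Fintype.card (PartialMatrix.Block S) →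
      PartialMatrix.IsBasicSemialgebraic (Function.uncurry '' PartialMatrix.completions M) ∧
      PartialMatrix.semialgebraicDim (Function.uncurry '' PartialMatrix.completions M) =
        ((Fintype.card (PartialMatrix.Block S) - 2 : ℕ) : WithBot ℕ∞)) :=
  ⟨PartialMatrix.existsUnique_completion_of_sum_sqrt_eq_one hpos hM,
    fun _ hcard ⟨_, hc⟩ =>
      PartialMatrix.existsUnique_completion_of_isIsolatedVertex hpos hM hcard hc,
    PartialMatrix.encard_completions_eq_two hpos hM,
    fun hb hcard => ⟨PartialMatrix.isBasicSemialgebraic_completions M,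
      PartialMatrix.semialgebraicDim_completions hpos hM hb hcard⟩⟩
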